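/- Let $1<p<\infty$, $0<\underline E\le\overline E<\infty$, $\underline\Sigma>0$, $\overline L<\infty$, and let $\chi_4:(0,\infty)\to[0,\infty)$ satisfy $\chi_4(r)\to0$ as $r\to0^+$. For a probability density $f$ on $\mathbb R$ put $$E=\int_{\mathbb R} v^2f(v)\,dv,\qquad \Sigma=\Bigl(\int_{\mathbb R}(v^2-E)^2f(v)\,dv\Bigr)^{1/2},\qquad Z_N(f,r)=\int_{S^{N-1}(r)}f^{\otimes N}\,d\sigma^N_r,$$ where $f^{\otimes N}(v)=\prod_{j=1}^N f(v_j)$ and $\sigma^N_r$ is the uniform probability measure on the sphere $S^{N-1}(r)$ of radius $r>0$ centred at $0$ in $\mathbb R^N$. Put also $$\gamma^{(N)}(r)=\frac{e^{-r^2/2}}{(2\pi)^{N/2}},\qquad \alpha_N(s)=s^{\frac N2-1}e^{-\frac s2}\quad(s>0).$$ Then there are a function $\omega:\mathbb N\to\mathbb R$ with $\omega(N)\to0$ as $N\to\infty$ and an integer $N_0$, both depending only on $\underline E,\overline E,\underline\Sigma,p,\overline L$ and $\chi_4$, such that the following holds for every probability density $f$ on $\mathbb R$ with finite fourth moment and $f\in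 L^p(\mathbb R)$ satisfying $$\underline E\le E\le\overline E,\qquad \Sigma\ge\underline\Sigma,\qquad \|f\|_{L^p}\le\overline L,\qquad \int_{|v|\ge 1/r}f(v)\,v^4\,dv\le\chi_4(r)\quad\text{for all } r>0,$$ and for every $N\ge N_0$. For every $r>0$, $f^{\otimes N}$ is $\sigma^N_r$-integrable, $Z_N(f,r)$ is unchanged if $f$ is modified on a Lebesgue-null subset of $\mathbb R$, and $$Z_N(f,r)=\frac{\sqrt2}{\Sigma}\,\gamma^{(N)}(r)\,\frac{\alpha_N(N)}{\alpha_N(r^2)}\Bigl[e^{-\frac{(r^2-NE)^2}{2N\Sigma^2}}+\varepsilon\Bigr]\quad\text{for some }\varepsilon=\varepsilon(N,f,r)\text{ with }|\varepsilon|\le\omega(N).$$ In particular, $$Z_N(f,\sqrt N)=\frac{\sqrt2}{\Sigma}\,\gamma^{(N)}(\sqrt N)\Bigl[e^{-\frac{N(1-E)^2}{2\Sigma^2}}+\varepsilon'\Bigr]\quad\text{for some }\varepsilon'=\varepsilon'(N,f)\text{ with }|\varepsilon'|\le\omega(N).$$ -/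

import Mathlib

open MeasureTheory Filter Topology

noncomputable section

namespace CondTensor

/-- The function `f` on the real line is a probability density with respect to Lebesgue measure
(as an almost everywhere defined function). -/
structure IsProbDensity (f : ℝ → ℝ) : Prop where
  nonneg : ∀ᵐ v, 0 ≤ f v
  integrable : Integrable f
  integral_eq_one : ∫ v, f v = 1

/-- The mean kinetic energy `E = ∫ f(v) v² dv`. -/
def energy (f : ℝ → ℝ) : ℝ := ∫ v, f v * v ^ 2

/-- The standard deviation `Σ = (∫ (v² - E)² f(v) dv)^{1/2}` of the kinetic energy. -/
def energyDev (f : ℝ → ℝ) : ℝ := Real.sqrt (∫ v, (v ^ 2 - energy f) ^ 2 * f v)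

/-- The uniform probability measure on the unit sphere of `ℝ^N`: the normalized surface measure
(a probability measure as soon as `N ≥ 1`). -/
def unitSphereUnif (N : ℕ) : Measure (Metric.sphere (0 : EuclideanSpace ℝ (Fin N)) 1) :=
  ((volume : Measure (EuclideanSpace ℝ (Fin N))).toSphere Set.univ)⁻¹ •
    (volume : Measure (EuclideanSpace ℝ (Fin N))).toSphere

/-- The uniform probability measure `σ^N_r` on the sphere `S^{N-1}(r)` of radius `r > 0` in `ℝ^N`,
as a measure on `ℝ^N` carried by that sphere: the image of the uniform probability measure on the
unit sphere under the dilation `y ↦ r y`. -/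
def sphereUnif (N : ℕ) (r : ℝ) : Measure (EuclideanSpace ℝ (Fin N)) :=
  (unitSphereUnif N).map
    fun y : Metric.sphere (0 : EuclideanSpace ℝ (Fin N)) 1 => r • (y : EuclideanSpace ℝ (Fin N))

/-- The tensor power `f^{⊗N}(v) = f(v_1) ⋯ f(v_N)`. -/
def tensorPow (f : ℝ → ℝ) (N : ℕ) (v : EuclideanSpace ℝ (Fin N)) : ℝ := ∏ i, f (v i)

/-- `Z_N(f, r) = ∫_{S^{N-1}(r)} f^{⊗N} dσ^N_r`. -/
def Z (N : ℕ) (f : ℝ → ℝ) (r : ℝ) : ℝ := ∫ v, tensorPow f N v ∂(sphereUnif N r)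

/-- `γ^{(N)}(r) = e^{-r²/2} / (2π)^{N/2}`, the constant value on `S^{N-1}(r)` of the standard
Gaussian density of `ℝ^N`. -/
def gaussRadial (N : ℕ) (r : ℝ) : ℝ :=
  Real.exp (-r ^ 2 / 2) / (2 * Real.pi) ^ ((N : ℝ) / 2)

/-- `α_N(s) = s^{N/2 - 1} e^{-s/2}`. -/
def alpha (N : ℕ) (s : ℝ) : ℝ := s ^ ((N : ℝ) / 2 - 1) * Real.exp (-s / 2)

end CondTensor

end

/-! ### Cyclic Hölder inequality, radial weights, polar coordinates -/

noncomputable section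

namespace CondTensor

open scoped ENNReal

/-! If the coordinates are sampled from `f^{⊗N}`, the squared norm is a sum of `N` independent
copies of `v²`, with mean `N E` and variance `N Σ²`. In polar coordinates its density at `s = r²`
(`energyDensity`) is `Z_N(f, r)` times `r^(N-2) / 2` times the area of the unit sphere. The theorem
is therefore a local central limit theorem for this density, uniform in `f` and `r`. The area is
removed by comparison with the standard Gaussian, whose tensor power is constant on spheres: its
energy density at `s = N` obeys the same local limit theorem with limit value exactly `1`, and the
quotient produces the factors `γ^{(N)}` and `α_N` (`Z_eq_mul_div`).

The difficulty is that `f` is only in `L^p` with `p` close to `1`: spheres are Lebesgue-null and the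
law of `v²` may have an unbounded density. Both problems are solved by the multilinear bound
`lintegral_surf_prod_le`: the surface integral of `∏ F_j(v_j)` is at most a constant times `∏
‖F_j‖_q` with `q = N / (N - 2)`. Indeed, after two coordinates are forgotten, the surface measure is
dominated by a multiple of Lebesgue measure on the other `N - 2`; Hölder's inequality over a cyclic
family of forgotten pairs then symmetrizes the estimate. Once `N` is large, `q ≤ p`, and one gets
integrability on spheres, insensitivity to null sets, and an energy density that is bounded and
continuous on the positive half-line.

On the Fourier side, let `φ = charSq f`. Plancherel applied to the bounded energy density of a fixed
number `m` of particles bounds `∫ |φ|^(2m)` uniformly in `f`. With the Lipschitz bound for `φ` this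
gives a uniform Cramér condition `|φ| ≤ 1 - κ` away from `0` (`exists_norm_charSq_le`). Near `0` the
tail function `χ` makes the second-order expansion uniform (`exists_norm_charSq_sub_taylor_le`).
Together they give a uniform `L¹` approximation of `φ^N` by a Gaussian, and Fourier inversion turns
it into the local limit theorem `exists_energyDensity_sub_gaussian_le`. -/

/-- The index `j` is omitted exactly for `i = j` and `i = σ⁻¹ j`, which differ because `σ` has no
fixed point; hence each factor survives `card ι - 2` times. -/
theorem prod_prod_sdiff_pair {ι M : Type*} [Fintype ι] [DecidableEq ι] [CommMonoid M]
    (σ : Equiv.Perm ι) (hσ : ∀ i, σ i ≠ i) (x : ι → M) :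
    ∏ i, ∏ j ∈ ({i, σ i} : Finset ι)ᶜ, x j = ∏ j, x j ^ (Fintype.card ι - 2) := by
  rw [Finset.prod_comm' (t' := Finset.univ) (s' := fun j => ({j, σ.symm j} : Finset ι)ᶜ)]
  · refine Finset.prod_congr rfl fun j _ => ?_
    rw [Finset.prod_const, Finset.card_compl, Finset.card_pair]
    intro h
    exact hσ j (by conv_lhs => rw [h]
                   simp)
  · intro i j
    simp only [Finset.mem_univ, Finset.mem_compl, Finset.mem_insert, Finset.mem_singleton, true_and,
      and_true, not_or, Equiv.eq_symm_apply]
    constructor <;> rintro ⟨h1, h2⟩ <;> exact ⟨fun h => h1 h.symm, fun h => h2 h.symm⟩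

/-- A Hölder inequality for products of functions: if the products omitting the pairs `{i, σ i}`
are controlled, then so is the full product, with a smaller exponent. -/
theorem lintegral_prod_le_of_omit_pair {ι α : Type*} [Fintype ι] [DecidableEq ι]
    [MeasurableSpace α] {μ : Measure α} (hcard : 3 ≤ Fintype.card ι)
    (σ : Equiv.Perm ι) (hσ : ∀ i, σ i ≠ i) {G : ι → α → ℝ≥0∞} (hG : ∀ i, AEMeasurable (G i) μ)
    {C : ℝ≥0∞} {K : ι → ℝ≥0∞} {q : ℝ}
    (hq : q = Fintype.card ι / (Fintype.card ι - 2))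
    (h : ∀ i, ∫⁻ a, ∏ j ∈ ({i, σ i} : Finset ι)ᶜ, G j a ^ q ∂μ
      ≤ C * ∏ j ∈ ({i, σ i} : Finset ι)ᶜ, K j) :
    ∫⁻ a, ∏ j, G j a ∂μ ≤ C * ∏ j, K j ^ (1 / q) := by
  set n := Fintype.card ι with hn
  have hn3 : (3 : ℝ) ≤ n := by exact_mod_cast hcard
  have hn0 : (n : ℝ) ≠ 0 := by positivity
  have hn2 : (n : ℝ) - 2 ≠ 0 := by linarith
  have hcast : ((n - 2 : ℕ) : ℝ) = n - 2 := by
    rw [Nat.cast_sub (by omega)]; norm_num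
  -- Hölder is used with `n` equal weights `1 / n`; each factor then carries the exponent `(n - 2) /
  -- n = 1 / q`.
  have key : ∀ x : ι → ℝ≥0∞, ∏ i, (∏ j ∈ ({i, σ i} : Finset ι)ᶜ, x j) ^ (1 / (n : ℝ))
      = ∏ j, x j ^ (1 / q) := by
    intro x
    rw [ENNReal.prod_rpow_of_nonneg (by positivity), prod_prod_sdiff_pair σ hσ,
      ← ENNReal.prod_rpow_of_nonneg (by positivity)]
    refine Finset.prod_congr rfl fun j _ => ?_
    rw [← ENNReal.rpow_natCast, ← ENNReal.rpow_mul, hcast, hq]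
    congr 1
    field_simp
  have hqq : q ≠ 0 := by rw [hq]; positivity
  calc ∫⁻ a, ∏ j, G j a ∂μ
      = ∫⁻ a, ∏ i, (∏ j ∈ ({i, σ i} : Finset ι)ᶜ, G j a ^ q) ^ (1 / (n : ℝ)) ∂μ := by
        refine lintegral_congr fun a => ?_
        rw [key]
        refine Finset.prod_congr rfl fun j _ => ?_
        rw [← ENNReal.rpow_mul, mul_one_div_cancel hqq, ENNReal.rpow_one]
    _ ≤ ∏ i, (∫⁻ a, ∏ j ∈ ({i, σ i} : Finset ι)ᶜ, G j a ^ q ∂μ) ^ (1 / (n : ℝ)) := by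
        refine ENNReal.lintegral_prod_norm_pow_le Finset.univ
          (fun i _ => Finset.aemeasurable_fun_prod _ fun j _ => (hG j).pow_const _) ?_
          (fun _ _ => by positivity)
        rw [Finset.sum_const, Finset.card_univ, ← hn, nsmul_eq_mul, mul_one_div_cancel hn0]
    _ ≤ ∏ i, (C * ∏ j ∈ ({i, σ i} : Finset ι)ᶜ, K j) ^ (1 / (n : ℝ)) := by
        gcongr with i _
        exact h i
    _ = C * ∏ j, K j ^ (1 / q) := by
        simp_rw [ENNReal.mul_rpow_of_nonneg _ _ (show 0 ≤ 1 / (n : ℝ) by positivity)]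
        rw [Finset.prod_mul_distrib, key, Finset.prod_const, Finset.card_univ, ← hn,
          ← ENNReal.rpow_natCast, ← ENNReal.rpow_mul, one_div_mul_cancel hn0, ENNReal.rpow_one]

/-- In polar coordinates the angle contributes `2π` and the substitution `u = ρ² + c` gives `ρ dρ =
du / 2`. There is only an inequality because `u` runs over `(c, ∞)`. -/
theorem lintegral_plane_radial_le {g : ℝ → ℝ≥0∞} (hg : Measurable g) (c : ℝ) :
    ∫⁻ x : ℝ, ∫⁻ y : ℝ, g (x ^ 2 + y ^ 2 + c) ≤ ENNReal.ofReal Real.pi * ∫⁻ u, g u := by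
  have h1 : ∫⁻ x : ℝ, ∫⁻ y : ℝ, g (x ^ 2 + y ^ 2 + c)
      = ∫⁻ p : ℝ × ℝ, g (p.1 ^ 2 + p.2 ^ 2 + c) := by
    rw [Measure.volume_eq_prod, lintegral_prod _ (by fun_prop)]
  have h2 : ∀ p : ℝ × ℝ, (polarCoord.symm p).1 ^ 2 + (polarCoord.symm p).2 ^ 2 + c
      = p.1 ^ 2 + c := by
    intro p
    simp only [polarCoord_symm_apply]
    nlinarith [Real.sin_sq_add_cos_sq p.2]
  have h3 : ∫⁻ ρ in Set.Ioi (0 : ℝ), ENNReal.ofReal |2 * ρ| * g (ρ ^ 2 + c) ≤ ∫⁻ u, g u := by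
    rw [← lintegral_image_eq_lintegral_abs_deriv_mul (f := fun ρ : ℝ => ρ ^ 2 + c)
      (f' := fun ρ => 2 * ρ) measurableSet_Ioi (fun ρ _ => ?_) ?_ g]
    · exact setLIntegral_le_lintegral _ _
    · intro a ha b hb hab
      have : a ^ 2 = b ^ 2 := by simpa using hab
      exact (pow_left_inj₀ (le_of_lt ha) (le_of_lt hb) two_ne_zero).1 this
    · simpa using (((hasDerivAt_id _).pow 2).add_const c).hasDerivWithinAt
  rw [h1, ← lintegral_comp_polarCoord_symm]
  simp_rw [h2, polarCoord_target, smul_eq_mul]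
  rw [Measure.volume_eq_prod, ← Measure.prod_restrict,
    lintegral_prod _ (by fun_prop)]
  simp only [lintegral_const, Measure.restrict_apply MeasurableSet.univ, Set.univ_inter,
    Real.volume_Ioo]
  rw [lintegral_mul_const _ (by fun_prop), mul_comm]
  calc _ = ENNReal.ofReal Real.pi * ∫⁻ ρ in Set.Ioi (0 : ℝ), ENNReal.ofReal |2 * ρ| * g (ρ ^ 2 + c) := by
        have : ENNReal.ofReal (Real.pi - -Real.pi) = ENNReal.ofReal Real.pi * 2 := by
          rw [show Real.pi - -Real.pi = Real.pi * 2 by ring, ENNReal.ofReal_mul Real.pi_pos.le]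
          norm_num
        rw [this, mul_assoc, ← lintegral_const_mul _ (by fun_prop)]
        congr 1
        refine setLIntegral_congr_fun measurableSet_Ioi fun ρ hρ => ?_
        have hρ : 0 < ρ := hρ
        rw [abs_of_pos (by positivity), ENNReal.ofReal_mul (by norm_num), ← mul_assoc]
        norm_num
    _ ≤ _ := by gcongr

/-- Integrating a radial weight over two coordinates costs at most `π ∫ g`. -/
theorem lintegral_radial_mul_restrict_le {ι : Type*} [Fintype ι] [DecidableEq ι]
    {i k : ι} (hik : i ≠ k) (A : Finset ι) (hA : A = {i, k}ᶜ) {g : ℝ → ℝ≥0∞} (hg : Measurable g)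
    {H : (A → ℝ) → ℝ≥0∞} (hH : Measurable H) :
    ∫⁻ x : ι → ℝ, g (∑ j, x j ^ 2) * H (A.restrict x)
      ≤ (ENNReal.ofReal Real.pi * ∫⁻ u, g u) * ∫⁻ y, H y := by
  have hrestr : Measurable (A.restrict : (ι → ℝ) → A → ℝ) := Finset.measurable_restrict A
  have hmF : Measurable fun x : ι → ℝ => g (∑ j, x j ^ 2) * H (A.restrict x) :=
    (hg.comp (by fun_prop)).mul (hH.comp hrestr)
  have hmem : ∀ j ∈ A, j ≠ i ∧ j ≠ k := by
    intro j hj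
    simpa [hA] using hj
  have hdisj : Disjoint A {i, k} := by rw [hA]; exact disjoint_compl_left
  have huniv : Finset.univ = A ∪ {i, k} := by
    ext j; simp [hA]; tauto
  -- With the other coordinates frozen, the weight is a radial function in the plane of the
  -- coordinates `i, k`, shifted by a constant.
  have hinner : ∫⋯∫⁻_{i, k}, (fun x => g (∑ j, x j ^ 2) * H (A.restrict x)) ∂(fun _ => volume)
      ≤ fun x => (ENNReal.ofReal Real.pi * ∫⁻ u, g u) * H (A.restrict x) := by
    intro x
    rw [lmarginal_insert _ hmF (by simpa using hik)]
    simp_rw [lmarginal_singleton]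
    have e1 : ∀ a b : ℝ,
        A.restrict (Function.update (Function.update x i a) k b) = A.restrict x := by
      intro a b
      ext ⟨j, hj⟩
      simp [Finset.restrict, Function.update_of_ne (hmem j hj).1,
        Function.update_of_ne (hmem j hj).2]
    have e2 : ∀ a b : ℝ, ∑ j, (Function.update (Function.update x i a) k b) j ^ 2
        = a ^ 2 + b ^ 2 + ∑ j ∈ A, x j ^ 2 := by
      intro a b
      rw [huniv, Finset.sum_union hdisj, Finset.sum_pair hik, Function.update_of_ne hik,
        Function.update_self, Function.update_self, add_comm]
      congr 1
      refine Finset.sum_congr rfl fun j hj => ?_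
      rw [Function.update_of_ne (hmem j hj).2, Function.update_of_ne (hmem j hj).1]
    simp_rw [e1, e2]
    have hm : ∀ a : ℝ, Measurable fun b : ℝ => g (a ^ 2 + b ^ 2 + ∑ j ∈ A, x j ^ 2) :=
      fun a => by fun_prop
    have hin : ∀ a : ℝ, ∫⁻ b : ℝ, g (a ^ 2 + b ^ 2 + ∑ j ∈ A, x j ^ 2) * H (A.restrict x)
        = (∫⁻ b : ℝ, g (a ^ 2 + b ^ 2 + ∑ j ∈ A, x j ^ 2)) * H (A.restrict x) :=
      fun a => lintegral_mul_const _ (hm a)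
    refine (lintegral_congr hin).trans_le ?_
    rw [lintegral_mul_const]
    · gcongr
      exact lintegral_plane_radial_le hg _
    · exact Measurable.lintegral_prod_right'
        (f := fun p : ℝ × ℝ => g (p.1 ^ 2 + p.2 ^ 2 + ∑ j ∈ A, x j ^ 2)) (by fun_prop)
  calc ∫⁻ x : ι → ℝ, g (∑ j, x j ^ 2) * H (A.restrict x)
      = (∫⋯∫⁻_Finset.univ, (fun x => g (∑ j, x j ^ 2) * H (A.restrict x))
          ∂(fun _ => volume)) (0 : ι → ℝ) := by
        simp [volume_pi]
    _ = (∫⋯∫⁻_A, ∫⋯∫⁻_{i, k}, (fun x => g (∑ j, x j ^ 2) * H (A.restrict x))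
          ∂(fun _ => volume) ∂(fun _ => volume)) (0 : ι → ℝ) := by
        rw [← lmarginal_union _ _ hmF hdisj, ← huniv]
    _ ≤ (∫⋯∫⁻_A, (fun x => (ENNReal.ofReal Real.pi * ∫⁻ u, g u) * H (A.restrict x))
          ∂(fun _ => volume)) (0 : ι → ℝ) := lmarginal_mono hinner _
    _ = _ := by
        have hr : ∀ y : A → ℝ, A.restrict (Function.updateFinset (0 : ι → ℝ) A y) = y := by
          intro y
          ext j
          simp [Finset.restrict, Function.updateFinset]
        simp only [lmarginal, hr]
        rw [lintegral_const_mul _ hH]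
        rfl

/-- Polar coordinates for the lower Lebesgue integral. -/
theorem lintegral_eq_lintegral_toSphere {E : Type*} [NormedAddCommGroup E] [NormedSpace ℝ E]
    [MeasurableSpace E] [BorelSpace E] [FiniteDimensional ℝ E] [Nontrivial E] (μ : Measure E)
    [μ.IsAddHaarMeasure] {F : E → ℝ≥0∞} (hF : Measurable F) :
    ∫⁻ x, F x ∂μ = ∫⁻ ρ in Set.Ioi (0 : ℝ), ENNReal.ofReal (ρ ^ (Module.finrank ℝ E - 1)) *
      ∫⁻ y, F (ρ • (y : E)) ∂μ.toSphere := by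
  conv_lhs => rw [← restrict_compl_singleton (μ := μ) 0,
    ← lintegral_subtype_comap (measurableSet_singleton _).compl]
  have h1 : ∀ x : ({0}ᶜ : Set E), F x = (fun p : Metric.sphere (0 : E) 1 × Set.Ioi (0 : ℝ) =>
      F ((p.2 : ℝ) • (p.1 : E))) (homeomorphUnitSphereProd E x) := by
    intro x
    simp only [homeomorphUnitSphereProd_apply_fst_coe, homeomorphUnitSphereProd_apply_snd_coe]
    rw [smul_inv_smul₀]
    exact norm_ne_zero_iff.2 x.2
  rw [lintegral_congr h1]
  have hmG : Measurable (fun p : Metric.sphere (0 : E) 1 × Set.Ioi (0 : ℝ) =>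
      F ((p.2 : ℝ) • (p.1 : E))) := by fun_prop
  rw [μ.measurePreserving_homeomorphUnitSphereProd.lintegral_comp hmG, lintegral_prod_symm' _ hmG,
    Measure.volumeIoiPow,
    lintegral_withDensity_eq_lintegral_mul _ (by fun_prop) hmG.lintegral_prod_left']
  simp only [Pi.mul_apply]
  rw [lintegral_subtype_comap measurableSet_Ioi (fun ρ : ℝ =>
    ENNReal.ofReal (ρ ^ (Module.finrank ℝ E - 1)) * ∫⁻ y, F (ρ • (y : E)) ∂μ.toSphere)]

end CondTensor

end

/-! ### The multilinear bound on spheres -/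

noncomputable section

namespace CondTensor

open scoped ENNReal

theorem lmarginal_prod_eq_prod_lintegral {ι : Type*} [DecidableEq ι] (s : Finset ι)
    {F : ι → ℝ → ℝ≥0∞} (hF : ∀ i, Measurable (F i)) :
    ∫⋯∫⁻_s, (fun x : ι → ℝ => ∏ j ∈ s, F j (x j)) ∂(fun _ => volume)
      = fun _ => ∏ j ∈ s, ∫⁻ u, F j u := by
  induction s using Finset.induction_on with
  | empty => simp
  | insert i s hi ih =>
    have hm : ∀ t : Finset ι, Measurable fun x : ι → ℝ => ∏ j ∈ t, F j (x j) := fun t =>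
      Finset.measurable_fun_prod _ fun j _ => (hF j).comp (measurable_pi_apply j)
    rw [lmarginal_insert' _ (hm _) hi]
    have h1 : ∀ x : ι → ℝ, ∫⁻ u, ∏ j ∈ insert i s, F j (Function.update x i u j)
        = (∫⁻ u, F i u) * ∏ j ∈ s, F j (x j) := by
      intro x
      rw [← lintegral_mul_const _ (hF i)]
      refine lintegral_congr fun u => ?_
      rw [Finset.prod_insert hi, Function.update_self]
      congr 1
      refine Finset.prod_congr rfl fun j hj => ?_
      rw [Function.update_of_ne]
      rintro rfl
      exact hi hj
    simp_rw [h1]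
    funext x
    have h2 := congrFun ih x
    simp only [lmarginal] at h2 ⊢
    rw [lintegral_const_mul, h2, Finset.prod_insert hi]
    exact (hm s).comp measurable_updateFinset

theorem lintegral_fintype_prod {ι : Type*} [Fintype ι] {F : ι → ℝ → ℝ≥0∞}
    (hF : ∀ i, Measurable (F i)) :
    ∫⁻ x : ι → ℝ, ∏ j, F j (x j) = ∏ j, ∫⁻ u, F j u := by
  classical
  have := congrFun (lmarginal_prod_eq_prod_lintegral Finset.univ hF) 0
  rwa [lmarginal_univ] at this

/-- The surface measure of the unit sphere of `ℝ^N`. -/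
abbrev surf (N : ℕ) : Measure (Metric.sphere (0 : EuclideanSpace ℝ (Fin N)) 1) :=
  (volume : Measure (EuclideanSpace ℝ (Fin N))).toSphere

theorem lintegral_pi_eq_lintegral_surf {N : ℕ} (hN : N ≠ 0) {F : (Fin N → ℝ) → ℝ≥0∞}
    (hF : Measurable F) :
    ∫⁻ x, F x = ∫⁻ ρ in Set.Ioi (0 : ℝ), ENNReal.ofReal (ρ ^ (N - 1)) *
      ∫⁻ y, F (ρ • (y : EuclideanSpace ℝ (Fin N))).ofLp ∂surf N := by
  have : NeZero N := ⟨hN⟩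
  have hmp := PiLp.volume_preserving_ofLp (Fin N)
  rw [← hmp.lintegral_comp hF]
  refine (lintegral_eq_lintegral_toSphere volume (F := fun x : EuclideanSpace ℝ (Fin N) => F x.ofLp)
    (hF.comp hmp.measurable)).trans ?_
  rw [finrank_euclideanSpace_fin]

theorem sum_sq_smul_sphere {N : ℕ} (ρ : ℝ) (y : Metric.sphere (0 : EuclideanSpace ℝ (Fin N)) 1) :
    ∑ j, (ρ • (y : EuclideanSpace ℝ (Fin N))).ofLp j ^ 2 = ρ ^ 2 := by
  have hy : ‖(y : EuclideanSpace ℝ (Fin N))‖ = 1 := by simp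
  rw [← EuclideanSpace.real_norm_sq_eq, norm_smul, hy, mul_one, Real.norm_eq_abs, sq_abs]

/-- A set on the sphere is null, so it is first thickened to a radial shell of width `δ`. The shell
has volume at least `δ r^(N-1)` times the surface measure, and `lintegral_radial_mul_restrict_le`
bounds it by `π ((r + δ)² - r²)` times the volume of `U`; the factor `δ` cancels. Openness of `U` is
what permits the thickening. -/
theorem surf_restrict_isOpen_le {N : ℕ} {i k : Fin N} (hik : i ≠ k) {A : Finset (Fin N)}
    (hA : A = {i, k}ᶜ) {U : Set (A → ℝ)} (hU : IsOpen U) {r : ℝ} (hr : 0 < r) :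
    surf N {y : Metric.sphere (0 : EuclideanSpace ℝ (Fin N)) 1 |
      A.restrict (r • (y : EuclideanSpace ℝ (Fin N))).ofLp ∈ U}
      ≤ ENNReal.ofReal (3 * Real.pi * (r ^ 2 / r ^ N)) * volume U := by
  have hN : 0 < N := i.pos
  have : Nonempty (Fin N) := ⟨i⟩
  -- Directions that stay in `U` throughout the shell of width `r / (n + 1)`. These sets increase
  -- with `n` and exhaust the set to be measured.
  let V : ℕ → Set (Metric.sphere (0 : EuclideanSpace ℝ (Fin N)) 1) := fun n =>
    {y | ∀ ρ ∈ Set.Ioo r (r + r / (n + 1)),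
      A.restrict (ρ • (y : EuclideanSpace ℝ (Fin N))).ofLp ∈ U}
  have hcont : ∀ y : Metric.sphere (0 : EuclideanSpace ℝ (Fin N)) 1,
      Continuous fun ρ : ℝ => A.restrict (ρ • (y : EuclideanSpace ℝ (Fin N))).ofLp := by
    intro y
    refine continuous_pi fun j => ?_
    simp only [Finset.restrict]
    fun_prop
  have hmono : Monotone V := by
    intro m n hmn y hy ρ hρ
    refine hy ρ ⟨hρ.1, hρ.2.trans_le ?_⟩
    gcongr
  have hsub : {y : Metric.sphere (0 : EuclideanSpace ℝ (Fin N)) 1 |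
      A.restrict (r • (y : EuclideanSpace ℝ (Fin N))).ofLp ∈ U} ⊆ ⋃ n, V n := by
    intro y hy
    have hev : ∀ᶠ ρ in 𝓝 r, A.restrict (ρ • (y : EuclideanSpace ℝ (Fin N))).ofLp ∈ U :=
      (hcont y).continuousAt.eventually (hU.mem_nhds hy)
    obtain ⟨δ, hδ, hball⟩ := Metric.eventually_nhds_iff.1 hev
    obtain ⟨n, hn⟩ := exists_nat_gt (r / δ)
    refine Set.mem_iUnion.2 ⟨n, fun ρ hρ => hball ?_⟩
    rw [Real.dist_eq, abs_of_pos (by linarith [hρ.1])]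
    have : r / (n + 1) < δ := by
      rw [div_lt_iff₀ (by positivity)]
      rw [div_lt_iff₀ hδ] at hn
      nlinarith
    linarith [hρ.2]
  refine (measure_mono hsub).trans ?_
  rw [hmono.measure_iUnion]
  refine iSup_le fun n => ?_
  set δ := r / ((n : ℝ) + 1) with hδdef
  have hδ : 0 < δ := by positivity
  -- This is the source of the constant `3`: `(r + δ)² - r² = δ (2 r + δ) ≤ 3 r δ`.
  have hδr : δ ≤ r := div_le_self hr.le (by linarith [(Nat.cast_nonneg n : (0 : ℝ) ≤ n)])
  let g : ℝ → ℝ≥0∞ := (Set.Ioo (r ^ 2) ((r + δ) ^ 2)).indicator 1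
  let H : (A → ℝ) → ℝ≥0∞ := U.indicator 1
  have hg : Measurable g := measurable_one.indicator measurableSet_Ioo
  have hH : Measurable H := measurable_one.indicator hU.measurableSet
  have hmF : Measurable fun x : Fin N → ℝ => g (∑ j, x j ^ 2) * H (A.restrict x) :=
    (hg.comp (by fun_prop)).mul (hH.comp (Finset.measurable_restrict A))
  have hup := lintegral_radial_mul_restrict_le hik A hA hg hH
  rw [lintegral_pi_eq_lintegral_surf hN.ne' hmF] at hup
  have hlow : ENNReal.ofReal δ * (ENNReal.ofReal (r ^ (N - 1)) * surf N (V n)) ≤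
      ∫⁻ ρ in Set.Ioi (0 : ℝ),
        ENNReal.ofReal (ρ ^ (N - 1)) *
        ∫⁻ y, g (∑ j, (ρ • (y : EuclideanSpace ℝ (Fin N))).ofLp j ^ 2) *
          H (A.restrict (ρ • (y : EuclideanSpace ℝ (Fin N))).ofLp) ∂surf N := by
    have hvol : ENNReal.ofReal δ = volume (Set.Ioo r (r + δ)) := by
      rw [Real.volume_Ioo]; congr 1; ring
    rw [hvol, mul_comm, ← setLIntegral_const]
    refine (setLIntegral_mono' measurableSet_Ioo fun ρ hρ => ?_).trans
      (lintegral_mono_set fun ρ hρ => hr.trans hρ.1)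
    refine mul_le_mul' (ENNReal.ofReal_le_ofReal (pow_le_pow_left₀ hr.le hρ.1.le _)) ?_
    calc surf N (V n) ≤ surf N {y : Metric.sphere (0 : EuclideanSpace ℝ (Fin N)) 1 |
            A.restrict (ρ • (y : EuclideanSpace ℝ (Fin N))).ofLp ∈ U} :=
          measure_mono fun y hy => hy ρ hρ
      _ = ∫⁻ y in {y : Metric.sphere (0 : EuclideanSpace ℝ (Fin N)) 1 |
            A.restrict (ρ • (y : EuclideanSpace ℝ (Fin N))).ofLp ∈ U}, 1 ∂surf N := by
          simp
      _ ≤ ∫⁻ y in {y : Metric.sphere (0 : EuclideanSpace ℝ (Fin N)) 1 |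
            A.restrict (ρ • (y : EuclideanSpace ℝ (Fin N))).ofLp ∈ U},
          g (∑ j, (ρ • (y : EuclideanSpace ℝ (Fin N))).ofLp j ^ 2) *
          H (A.restrict (ρ • (y : EuclideanSpace ℝ (Fin N))).ofLp) ∂surf N := by
          refine setLIntegral_mono_ae' ?_ (.of_forall fun y hy => ?_)
          · refine hU.measurableSet.preimage ((Finset.measurable_restrict A).comp ?_)
            fun_prop
          · have h1 := sum_sq_smul_sphere ρ y
            have h2 : ρ ^ 2 ∈ Set.Ioo (r ^ 2) ((r + δ) ^ 2) := by
              constructor <;> nlinarith [hρ.1, hρ.2]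
            simp only [g, H, h1]
            have hy' : A.restrict (ρ • (y : EuclideanSpace ℝ (Fin N))).ofLp ∈ U := hy
            rw [Set.indicator_of_mem h2, Set.indicator_of_mem hy']
            simp
      _ ≤ _ := setLIntegral_le_lintegral _ _
  have h3 := hlow.trans hup
  have hgint : ∫⁻ u, g u = ENNReal.ofReal ((r + δ) ^ 2 - r ^ 2) := by
    simp only [g]
    rw [lintegral_indicator_one measurableSet_Ioo, Real.volume_Ioo]
  have hHint : ∫⁻ y, H y = volume U := by
    simp only [H]
    rw [lintegral_indicator_one hU.measurableSet]
  rw [hgint, hHint, ← mul_assoc, ← ENNReal.ofReal_mul hδ.le, ← ENNReal.ofReal_mul Real.pi_pos.le]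
    at h3
  have hpos : 0 < δ * r ^ (N - 1) := by positivity
  have h4 : surf N (V n) ≤ (ENNReal.ofReal (δ * r ^ (N - 1)))⁻¹ *
      (ENNReal.ofReal (Real.pi * ((r + δ) ^ 2 - r ^ 2)) * volume U) := by
    exact (ENNReal.mul_le_iff_le_inv (by simpa using hpos) (by simp)).1 h3
  refine h4.trans ?_
  rw [← mul_assoc, ← ENNReal.ofReal_inv_of_pos hpos, ← ENNReal.ofReal_mul (by positivity)]
  refine mul_le_mul' (ENNReal.ofReal_le_ofReal ?_) le_rfl
  have hrN : r ^ N = r ^ (N - 1) * r := by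
    rw [← pow_succ, Nat.sub_add_cancel hN]
  rw [hrN, inv_mul_le_iff₀ hpos]
  have : δ * r ^ (N - 1) * (3 * Real.pi * (r ^ 2 / (r ^ (N - 1) * r))) = 3 * Real.pi * δ * r := by
    field_simp
  rw [this]
  nlinarith [Real.pi_pos, mul_pos Real.pi_pos hδ]

theorem lintegral_surf_restrict_le {N : ℕ} {i k : Fin N} (hik : i ≠ k) {A : Finset (Fin N)}
    (hA : A = {i, k}ᶜ) {H : (A → ℝ) → ℝ≥0∞} (hH : Measurable H) {r : ℝ} (hr : 0 < r) :
    ∫⁻ y, H (A.restrict (r • (y : EuclideanSpace ℝ (Fin N))).ofLp) ∂surf N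
      ≤ ENNReal.ofReal (3 * Real.pi * (r ^ 2 / r ^ N)) * ∫⁻ x, H x := by
  have hm : Measurable fun y : Metric.sphere (0 : EuclideanSpace ℝ (Fin N)) 1 =>
      A.restrict (r • (y : EuclideanSpace ℝ (Fin N))).ofLp :=
    (Finset.measurable_restrict A).comp (by fun_prop)
  have hle : (surf N).map (fun y : Metric.sphere (0 : EuclideanSpace ℝ (Fin N)) 1 =>
      A.restrict (r • (y : EuclideanSpace ℝ (Fin N))).ofLp)
      ≤ ENNReal.ofReal (3 * Real.pi * (r ^ 2 / r ^ N)) • volume := by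
    have := Measure.OuterRegular.smul (volume : Measure (A → ℝ))
      (ENNReal.ofReal_ne_top (r := 3 * Real.pi * (r ^ 2 / r ^ N)))
    -- Outer regularity of Lebesgue measure passes from open sets to all measurable sets.
    refine Measure.le_iff.2 fun s hs => ?_
    rw [s.measure_eq_iInf_isOpen (ENNReal.ofReal (3 * Real.pi * (r ^ 2 / r ^ N)) • volume)]
    refine le_iInf fun U => le_iInf fun hsU => le_iInf fun hU => ?_
    refine (measure_mono hsU).trans ?_
    rw [Measure.map_apply hm hU.measurableSet]
    exact surf_restrict_isOpen_le hik hA hU hr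
  rw [← lintegral_map hH hm]
  refine (lintegral_mono' hle le_rfl).trans ?_
  rw [lintegral_smul_measure, smul_eq_mul]

/-- Multilinear bound for products of functions of the coordinates on a sphere. -/
theorem lintegral_surf_prod_le {N : ℕ} (hN : 3 ≤ N) {F : Fin N → ℝ → ℝ≥0∞}
    (hF : ∀ j, Measurable (F j)) {q : ℝ} (hq : q = N / (N - 2)) {r : ℝ} (hr : 0 < r) :
    ∫⁻ y, ∏ j, F j ((r • (y : EuclideanSpace ℝ (Fin N))).ofLp j) ∂surf N
      ≤ ENNReal.ofReal (3 * Real.pi * (r ^ 2 / r ^ N)) * ∏ j, (∫⁻ u, F j u ^ q) ^ (1 / q) := by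
  obtain ⟨n, rfl⟩ : ∃ n, N = n + 2 := ⟨N - 2, by omega⟩
  -- The cyclic shift is fixed-point free as soon as there are two coordinates; the forgotten pairs
  -- are the cyclic neighbours.
  have hσ : ∀ i : Fin (n + 2), finRotate (n + 2) i ≠ i := by
    intro i
    rw [finRotate_apply]
    simp
  refine lintegral_prod_le_of_omit_pair (by simpa using hN) (finRotate (n + 2)) hσ
    (fun j => ((hF j).comp (by fun_prop)).aemeasurable) (by simpa using hq) fun i => ?_
  have hFq : ∀ j, Measurable fun u => F j u ^ q := fun j => (hF j).pow_const q
  have hm : ∀ A : Finset (Fin (n + 2)), Measurable fun x : A → ℝ => ∏ j : A, F j (x j) ^ q :=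
    fun A => Finset.measurable_fun_prod _ fun j _ => (hFq j).comp (measurable_pi_apply j)
  have := lintegral_surf_restrict_le (hσ i).symm rfl (hm ({i, finRotate (n + 2) i}ᶜ)) hr
  rw [lintegral_fintype_prod (F := fun j : (({i, finRotate (n + 2) i}ᶜ : Finset (Fin (n + 2)))) =>
    fun u => F j u ^ q) (fun j => hFq j)] at this
  rw [Finset.prod_coe_sort _ (fun j => ∫⁻ u, F j u ^ q)] at this
  refine le_trans (le_of_eq ?_) this
  refine lintegral_congr fun y => ?_
  simp only [Finset.restrict]
  rw [Finset.prod_coe_sort _ (fun j => F j ((r • (y : EuclideanSpace ℝ (Fin (n + 2)))).ofLp j) ^ q)]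
  rfl

end CondTensor

end

/-! ### Perturbation and continuity of sphere integrals -/

noncomputable section

namespace CondTensor

open scoped ENNReal

/-- Telescoping. The untouched factors are bounded crudely by `|a i| + |b i|`, so that every summand
is again a product of one-variable functions, to which the multilinear bound applies. -/
theorem abs_prod_sub_prod_le {ι : Type*} [DecidableEq ι] (s : Finset ι) (a b : ι → ℝ) :
    |∏ i ∈ s, a i - ∏ i ∈ s, b i|
      ≤ ∑ j ∈ s, ∏ i ∈ s, if i = j then |a i - b i| else |a i| + |b i| := by
  induction s using Finset.induction_on with
  | empty => simp
  | insert k s hk ih =>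
    rw [Finset.prod_insert hk, Finset.prod_insert hk, Finset.sum_insert hk, Finset.prod_insert hk,
      if_pos rfl]
    have h1 : ∏ i ∈ s, (if i = k then |a i - b i| else |a i| + |b i|)
        = ∏ i ∈ s, (|a i| + |b i|) :=
      Finset.prod_congr rfl fun i hi => if_neg (by rintro rfl; exact hk hi)
    have h2 : ∀ j ∈ s, ∏ i ∈ insert k s, (if i = j then |a i - b i| else |a i| + |b i|)
        = (|a k| + |b k|) * ∏ i ∈ s, (if i = j then |a i - b i| else |a i| + |b i|) := by
      intro j hj
      rw [Finset.prod_insert hk, if_neg (by rintro rfl; exact hk hj)]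
    rw [h1, Finset.sum_congr rfl h2, ← Finset.mul_sum]
    have h3 : a k * ∏ i ∈ s, a i - b k * ∏ i ∈ s, b i
        = (a k - b k) * ∏ i ∈ s, a i + b k * (∏ i ∈ s, a i - ∏ i ∈ s, b i) := by ring
    rw [h3]
    refine (abs_add_le _ _).trans (add_le_add ?_ ?_)
    · rw [abs_mul, Finset.abs_prod]
      gcongr with i _
      exact le_add_of_nonneg_right (abs_nonneg _)
    · rw [abs_mul]
      refine mul_le_mul (le_add_of_nonneg_left (abs_nonneg _)) ih (abs_nonneg _) (by positivity)

theorem lintegral_surf_enorm_prod_le {N : ℕ} (hN : 3 ≤ N) {h : Fin N → ℝ → ℝ}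
    (hh : ∀ j, Measurable (h j)) {q : ℝ} (hq : q = N / (N - 2)) {r : ℝ} (hr : 0 < r) :
    ∫⁻ y, ‖∏ j, h j ((r • (y : EuclideanSpace ℝ (Fin N))).ofLp j)‖ₑ ∂surf N
      ≤ ENNReal.ofReal (3 * Real.pi * (r ^ 2 / r ^ N)) *
        ∏ j, eLpNorm (h j) (ENNReal.ofReal q) volume := by
  have hN' : (3 : ℝ) ≤ N := by exact_mod_cast hN
  have hq0 : 0 < q := by rw [hq]; exact div_pos (by linarith) (by linarith)
  have := lintegral_surf_prod_le hN (fun j => (hh j).enorm) hq hr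
  have hnorm : ∀ j, (∫⁻ u, ‖h j u‖ₑ ^ q) ^ (1 / q) = eLpNorm (h j) (ENNReal.ofReal q) volume := by
    intro j
    rw [eLpNorm_eq_lintegral_rpow_enorm_toReal (by simpa using hq0) (by simp),
      ENNReal.toReal_ofReal hq0.le]
  simp_rw [hnorm] at this
  refine le_trans (le_of_eq (lintegral_congr fun y => ?_)) this
  simp_rw [← ofReal_norm]
  rw [norm_prod, ENNReal.ofReal_prod_of_nonneg fun _ _ => norm_nonneg _]

/-- The integral of `f^{⊗N}` over the sphere of radius `r`, with respect to the image of the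
unnormalized surface measure of the unit sphere. -/
def sphereInt (N : ℕ) (f : ℝ → ℝ) (r : ℝ) : ℝ :=
  ∫ y, ∏ j, f ((r • (y : EuclideanSpace ℝ (Fin N))).ofLp j) ∂surf N

theorem measurable_prod_smul {N : ℕ} {f : ℝ → ℝ} (hf : Measurable f) (r : ℝ) :
    Measurable fun y : Metric.sphere (0 : EuclideanSpace ℝ (Fin N)) 1 =>
      ∏ j, f ((r • (y : EuclideanSpace ℝ (Fin N))).ofLp j) :=
  Finset.measurable_fun_prod _ fun j _ => hf.comp (by fun_prop)

theorem integrable_surf_prod {N : ℕ} (hN : 3 ≤ N) {f : ℝ → ℝ} (hf : Measurable f) {q : ℝ}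
    (hq : q = N / (N - 2)) (hfq : eLpNorm f (ENNReal.ofReal q) volume < ∞) {r : ℝ} (hr : 0 < r) :
    Integrable (fun y : Metric.sphere (0 : EuclideanSpace ℝ (Fin N)) 1 =>
      ∏ j, f ((r • (y : EuclideanSpace ℝ (Fin N))).ofLp j)) (surf N) := by
  refine ⟨(measurable_prod_smul hf r).aestronglyMeasurable, ?_⟩
  refine (lintegral_surf_enorm_prod_le hN (fun _ => hf) hq hr).trans_lt ?_
  exact ENNReal.mul_lt_top (by simp) (ENNReal.prod_lt_top fun _ _ => hfq)

theorem abs_sphereInt_le {N : ℕ} (hN : 3 ≤ N) {f : ℝ → ℝ} (hf : Measurable f) {q : ℝ}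
    (hq : q = N / (N - 2)) (hfq : eLpNorm f (ENNReal.ofReal q) volume < ∞) {r : ℝ} (hr : 0 < r) :
    |sphereInt N f r| ≤ 3 * Real.pi * (r ^ 2 / r ^ N) *
      (eLpNorm f (ENNReal.ofReal q) volume).toReal ^ N := by
  have h1 := lintegral_surf_enorm_prod_le hN (fun _ => hf) hq hr
  have h2 : ‖sphereInt N f r‖ₑ ≤ _ := (enorm_integral_le_lintegral_enorm _).trans h1
  rw [Finset.prod_const, Finset.card_univ, Fintype.card_fin] at h2
  have h3 := ENNReal.toReal_mono
    (ENNReal.mul_lt_top (by simp) (ENNReal.pow_lt_top hfq)).ne h2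
  rw [ENNReal.toReal_mul, ENNReal.toReal_ofReal (by positivity), ENNReal.toReal_pow] at h3
  simpa using h3

theorem abs_sphereInt_sub_le {N : ℕ} (hN : 3 ≤ N) {f g : ℝ → ℝ} (hf : Measurable f)
    (hg : Measurable g) {q : ℝ} (hq : q = N / (N - 2)) {M ε : ℝ} (hM : 0 ≤ M) (hε : 0 ≤ ε)
    (hfM : eLpNorm f (ENNReal.ofReal q) volume ≤ ENNReal.ofReal M)
    (hgM : eLpNorm g (ENNReal.ofReal q) volume ≤ ENNReal.ofReal M)
    (hfg : eLpNorm (f - g) (ENNReal.ofReal q) volume ≤ ENNReal.ofReal ε) {r : ℝ} (hr : 0 < r) :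
    |sphereInt N f r - sphereInt N g r| ≤
      N * (3 * Real.pi * (r ^ 2 / r ^ N) * (ε * (M + M) ^ (N - 1))) := by
  have hN' : (3 : ℝ) ≤ N := by exact_mod_cast hN
  have hq1 : 1 ≤ q := by
    rw [hq, le_div_iff₀ (by linarith)]; linarith
  rw [sphereInt, sphereInt, ← integral_sub
    (integrable_surf_prod hN hf hq (hfM.trans_lt (by simp)) hr)
    (integrable_surf_prod hN hg hq (hgM.trans_lt (by simp)) hr)]
  let h : Fin N → Fin N → ℝ → ℝ := fun j i =>
    if i = j then fun u => |f u - g u| else fun u => |f u| + |g u|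
  have hh : ∀ j i, Measurable (h j i) := by
    intro j i
    by_cases hij : i = j
    · simp only [h, hij, if_true]; fun_prop
    · simp only [h, hij, if_false]; fun_prop
  have hnorm : ∀ j i, eLpNorm (h j i) (ENNReal.ofReal q) volume
      ≤ ENNReal.ofReal (if i = j then ε else M + M) := by
    intro j i
    by_cases hij : i = j
    · simp only [h, hij, if_true]
      exact (eLpNorm_norm (f - g)).trans_le hfg
    · simp only [h, hij, if_false]
      refine (eLpNorm_add_le (f := fun u => |f u|) (g := fun u => |g u|)
        hf.abs.aestronglyMeasurable hg.abs.aestronglyMeasurable (by simpa using hq1)).trans ?_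
      rw [ENNReal.ofReal_add hM hM]
      exact add_le_add ((eLpNorm_norm f).trans_le hfM) ((eLpNorm_norm g).trans_le hgM)
  have h1 : ∀ y : Metric.sphere (0 : EuclideanSpace ℝ (Fin N)) 1,
      ‖∏ j, f ((r • (y : EuclideanSpace ℝ (Fin N))).ofLp j)
        - ∏ j, g ((r • (y : EuclideanSpace ℝ (Fin N))).ofLp j)‖ₑ
      ≤ ∑ j, ‖∏ i, h j i ((r • (y : EuclideanSpace ℝ (Fin N))).ofLp i)‖ₑ := by
    intro y
    have hnn : ∀ j i u, 0 ≤ h j i u := by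
      intro j i u
      by_cases hij : i = j
      · simp only [h, hij, if_true]; positivity
      · simp only [h, hij, if_false]; positivity
    have e1 : ∀ j, ‖∏ i, h j i ((r • (y : EuclideanSpace ℝ (Fin N))).ofLp i)‖ₑ
        = ENNReal.ofReal (∏ i, h j i ((r • (y : EuclideanSpace ℝ (Fin N))).ofLp i)) := fun j =>
      Real.enorm_of_nonneg (Finset.prod_nonneg fun i _ => hnn _ _ _)
    simp_rw [e1]
    rw [← ENNReal.ofReal_sum_of_nonneg fun j _ => Finset.prod_nonneg fun i _ => hnn _ _ _,
      ← ofReal_norm]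
    refine ENNReal.ofReal_le_ofReal ((abs_prod_sub_prod_le Finset.univ _ _).trans (le_of_eq ?_))
    refine Finset.sum_congr rfl fun j _ => Finset.prod_congr rfl fun i _ => ?_
    by_cases hij : i = j <;> simp [h, hij]
  have h2 : ‖∫ y, (∏ j, f ((r • (y : EuclideanSpace ℝ (Fin N))).ofLp j)
        - ∏ j, g ((r • (y : EuclideanSpace ℝ (Fin N))).ofLp j)) ∂surf N‖ₑ
      ≤ ENNReal.ofReal (N * (3 * Real.pi * (r ^ 2 / r ^ N) * (ε * (M + M) ^ (N - 1)))) := by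
    refine (enorm_integral_le_lintegral_enorm _).trans ?_
    refine (lintegral_mono h1).trans ?_
    rw [lintegral_finsetSum]
    swap
    · intro j _
      exact (Finset.measurable_fun_prod _ fun i _ => (hh j i).comp (by fun_prop)).enorm
    have h3 : ∀ j ∈ (Finset.univ : Finset (Fin N)),
        ∫⁻ y, ‖∏ i, h j i ((r • (y : EuclideanSpace ℝ (Fin N))).ofLp i)‖ₑ ∂surf N
        ≤ ENNReal.ofReal (3 * Real.pi * (r ^ 2 / r ^ N) * (ε * (M + M) ^ (N - 1))) := by
      intro j _
      refine (lintegral_surf_enorm_prod_le hN (hh j) hq hr).trans ?_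
      rw [ENNReal.ofReal_mul (p := 3 * Real.pi * (r ^ 2 / r ^ N)) (by positivity)]
      refine mul_le_mul' le_rfl ?_
      refine le_trans (b := ∏ i, ENNReal.ofReal (if i = j then ε else M + M)) ?_ (le_of_eq ?_)
      · exact Finset.prod_le_prod' fun i _ => hnorm j i
      rw [← ENNReal.ofReal_prod_of_nonneg]
      · congr 1
        rw [Finset.prod_ite, Finset.prod_const, Finset.prod_const]
        simp [Finset.filter_eq', Finset.filter_ne', Finset.card_erase_of_mem]
      · intro i _
        split_ifs <;> positivity
    refine (Finset.sum_le_sum h3).trans (le_of_eq ?_)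
    rw [Finset.sum_const, Finset.card_univ, Fintype.card_fin, nsmul_eq_mul,
      ENNReal.ofReal_mul (p := (N : ℝ)) (by positivity), ENNReal.ofReal_natCast]
  have h4 := ENNReal.toReal_mono ENNReal.ofReal_ne_top h2
  rw [ENNReal.toReal_ofReal (by positivity)] at h4
  simpa using h4

theorem continuous_sphereInt {N : ℕ} {g : ℝ → ℝ} (hg : Continuous g) :
    Continuous (sphereInt N g) := by
  have := continuous_parametric_integral_of_continuous (μ := surf N)
    (f := fun (r : ℝ) (y : Metric.sphere (0 : EuclideanSpace ℝ (Fin N)) 1) =>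
      ∏ j, g ((r • (y : EuclideanSpace ℝ (Fin N))).ofLp j))
    (by simp only [Function.uncurry_def]; fun_prop) (isCompact_univ)
  simp only [Measure.restrict_univ] at this
  exact this

/-- Approximation of `f` in `L^q` by continuous functions is, by `abs_sphereInt_sub_le`, locally
uniform approximation of the sphere integrals on `r > 0`, and those of continuous functions are
continuous. -/
theorem continuousOn_sphereInt {N : ℕ} (hN : 3 ≤ N) {f : ℝ → ℝ} (hf : Measurable f) {q : ℝ}
    (hq : q = N / (N - 2)) (hfq : eLpNorm f (ENNReal.ofReal q) volume < ∞) :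
    ContinuousOn (sphereInt N f) (Set.Ioi 0) := by
  have hN' : (3 : ℝ) ≤ N := by exact_mod_cast hN
  have hq1 : 1 ≤ q := by
    rw [hq, le_div_iff₀ (by linarith)]; linarith
  -- The added `1` leaves room for the approximant, whose norm exceeds that of `f` by at most `ε ≤
  -- 1`.
  set M : ℝ := (eLpNorm f (ENNReal.ofReal q) volume).toReal + 1 with hMdef
  have hM : 0 ≤ M := by positivity
  have hfM' : eLpNorm f (ENNReal.ofReal q) volume = ENNReal.ofReal (M - 1) := by
    simp [hMdef, hfq.ne]
  have hfM : eLpNorm f (ENNReal.ofReal q) volume ≤ ENNReal.ofReal M := by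
    rw [hfM']; exact ENNReal.ofReal_le_ofReal (by linarith)
  intro r₀ hr₀
  have hr₀ : 0 < r₀ := hr₀
  have hloc : ContinuousOn (sphereInt N f) (Set.Ioi (r₀ / 2)) := by
    refine continuousOn_of_uniform_approx_of_continuousOn fun u hu => ?_
    obtain ⟨η, hη, hηu⟩ := Metric.mem_uniformity_dist.1 hu
    set K : ℝ := N * (3 * Real.pi * (1 / (r₀ / 2) ^ (N - 2)) * (M + M) ^ (N - 1)) with hK
    have hK0 : 0 ≤ K := by positivity
    set ε : ℝ := min 1 (η / (K + 1) / 2) with hεdef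
    have hε : 0 < ε := by positivity
    obtain ⟨g, -, hfg, hgc, hgm⟩ := MemLp.exists_hasCompactSupport_eLpNorm_sub_le
      (p := ENNReal.ofReal q) (μ := volume) (by simp) (f := f) ⟨hf.aestronglyMeasurable, hfq⟩
      (ε := ENNReal.ofReal ε) (by simpa using hε)
    have hgM : eLpNorm g (ENNReal.ofReal q) volume ≤ ENNReal.ofReal M := by
      have h1 : g = f - (f - g) := by simp
      rw [h1]
      refine (eLpNorm_sub_le hf.aestronglyMeasurable
        (hf.sub hgc.measurable).aestronglyMeasurable (by simpa using hq1)).trans ?_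
      rw [hfM']
      refine (add_le_add_right hfg _).trans ?_
      rw [← ENNReal.ofReal_add (by simp [hMdef]) hε.le]
      exact ENNReal.ofReal_le_ofReal (by linarith [min_le_left (1 : ℝ) (η / (K + 1) / 2)])
    refine ⟨sphereInt N g, (continuous_sphereInt hgc).continuousOn, fun r hr => hηu ?_⟩
    have hr : r₀ / 2 < r := hr
    have hrpos : 0 < r := by linarith
    rw [Real.dist_eq]
    refine (abs_sphereInt_sub_le hN hf hgc.measurable hq hM hε.le hfM hgM hfg hrpos).trans_lt ?_
    have hpow : r ^ 2 / r ^ N ≤ 1 / (r₀ / 2) ^ (N - 2) := by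
      have : r ^ N = r ^ 2 * r ^ (N - 2) := by rw [← pow_add]; congr 1; omega
      rw [this, div_mul_eq_div_div, div_self (by positivity)]
      gcongr
    have h5 : N * (3 * Real.pi * (r ^ 2 / r ^ N) * (ε * (M + M) ^ (N - 1))) ≤ ε * K := by
      have : ε * K = N * (3 * Real.pi * (1 / (r₀ / 2) ^ (N - 2)) * (ε * (M + M) ^ (N - 1))) := by
        rw [hK]; ring
      rw [this]
      gcongr
    have h6 : ε * K < η := by
      have : ε ≤ η / (K + 1) / 2 := min_le_right _ _
      calc ε * K ≤ η / (K + 1) / 2 * (K + 1) := by gcongr; linarith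
        _ = η / 2 := by field_simp
        _ < η := by linarith
    linarith
  exact (hloc.continuousAt (Ioi_mem_nhds (by linarith))).continuousWithinAt

end CondTensor

end

/-! ### Null sets, and the law of the total energy -/

noncomputable section

namespace CondTensor

open scoped ENNReal

theorem ae_surf_notMem {N : ℕ} (hN : 3 ≤ N) {t : Set ℝ} (ht : MeasurableSet t)
    (ht0 : volume t = 0) {r : ℝ} (hr : 0 < r) (j : Fin N) :
    ∀ᵐ y : Metric.sphere (0 : EuclideanSpace ℝ (Fin N)) 1 ∂surf N, (r • (y : EuclideanSpace ℝ (Fin N))).ofLp j ∉ t := by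
  have hN' : (3 : ℝ) ≤ N := by exact_mod_cast hN
  set q : ℝ := N / (N - 2) with hq
  have hq0 : 0 < q := div_pos (by linarith) (by linarith)
  -- The factors with `i ≠ j` have infinite norm, but in `ℝ≥0∞` the single vanishing factor makes
  -- the product zero.
  let F : Fin N → ℝ → ℝ≥0∞ := fun i => if i = j then t.indicator 1 else 1
  have hF : ∀ i, Measurable (F i) := by
    intro i
    by_cases hij : i = j
    · simp only [F, hij, if_true]; exact measurable_one.indicator ht
    · simp only [F, hij, if_false]; exact measurable_one
  have h1 := lintegral_surf_prod_le hN hF hq hr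
  have h2 : ∏ i, (∫⁻ u, F i u ^ q) ^ (1 / q) = 0 := by
    refine Finset.prod_eq_zero (Finset.mem_univ j) ?_
    have : ∀ u, F j u ^ q = t.indicator 1 u := by
      intro u
      by_cases hu : u ∈ t <;> simp [F, hu, hq0]
    simp_rw [this]
    rw [lintegral_indicator_one ht, ht0, ENNReal.zero_rpow_of_pos (by positivity)]
  rw [h2, mul_zero, nonpos_iff_eq_zero, lintegral_eq_zero_iff] at h1
  · filter_upwards [h1] with y hy hmem
    have h3 : ∀ i, F i ((r • (y : EuclideanSpace ℝ (Fin N))).ofLp i) ≠ 0 := by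
      intro i
      by_cases hij : i = j
      · subst hij
        simp only [F, if_true]
        rw [Set.indicator_of_mem hmem]
        simp
      · simp [F, hij]
    exact Finset.prod_ne_zero_iff.2 (fun i _ => h3 i) hy
  · exact Finset.measurable_fun_prod _ fun i _ => (hF i).comp (by fun_prop)

theorem tensorPow_ae_eq {N : ℕ} (hN : 3 ≤ N) {f g : ℝ → ℝ} (hfg : f =ᵐ[volume] g) {r : ℝ}
    (hr : 0 < r) : tensorPow f N =ᵐ[sphereUnif N r] tensorPow g N := by
  set t := toMeasurable volume {u | f u ≠ g u} with htdef
  have ht : MeasurableSet t := measurableSet_toMeasurable _ _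
  have ht0 : volume t = 0 := by rw [htdef, measure_toMeasurable]; exact hfg
  have hsub : ∀ u, u ∉ t → f u = g u := by
    intro u hu
    by_contra hne
    exact hu (subset_toMeasurable _ _ hne)
  have hm : MeasurableSet {v : EuclideanSpace ℝ (Fin N) | ∀ j, v j ∉ t} := by
    have : {v : EuclideanSpace ℝ (Fin N) | ∀ j, v j ∉ t}
        = ⋂ j, (fun v : EuclideanSpace ℝ (Fin N) => v j) ⁻¹' tᶜ := by
      ext v; simp
    rw [this]
    exact MeasurableSet.iInter fun j => ht.compl.preimage (by fun_prop)
  have h1 : ∀ᵐ v ∂sphereUnif N r, ∀ j, v j ∉ t := by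
    rw [sphereUnif, ae_map_iff (by fun_prop) hm]
    exact Measure.ae_smul_measure (ae_all_iff.2 fun j => ae_surf_notMem hN ht ht0 hr j) _
  filter_upwards [h1] with v hv
  exact Finset.prod_congr rfl fun j _ => hsub _ (hv j)

theorem measurable_tensorPow {N : ℕ} {f : ℝ → ℝ} (hf : Measurable f) :
    Measurable (tensorPow f N) :=
  Finset.measurable_fun_prod _ fun j _ => hf.comp (by fun_prop)

theorem surf_univ_ne_zero {N : ℕ} (hN : N ≠ 0) : surf N Set.univ ≠ 0 := by
  have : NeZero N := ⟨hN⟩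
  have : Nonempty (Fin N) := ⟨0⟩
  exact Measure.measure_univ_ne_zero.2 (Measure.toSphere_ne_zero _)

theorem integrable_tensorPow {N : ℕ} (hN : 3 ≤ N) {f : ℝ → ℝ} (hf : Measurable f) {q : ℝ}
    (hq : q = N / (N - 2)) (hfq : eLpNorm f (ENNReal.ofReal q) volume < ∞) {r : ℝ} (hr : 0 < r) :
    Integrable (tensorPow f N) (sphereUnif N r) := by
  rw [sphereUnif, integrable_map_measure (measurable_tensorPow hf).aestronglyMeasurable
    (by fun_prop)]
  exact (integrable_surf_prod hN hf hq hfq hr).smul_measure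
    (ENNReal.inv_ne_top.2 (surf_univ_ne_zero (by omega)))

theorem Z_eq_sphereInt {N : ℕ} {f : ℝ → ℝ} (hf : Measurable f) (r : ℝ) :
    Z N f r = ((surf N).real Set.univ)⁻¹ * sphereInt N f r := by
  rw [Z, sphereUnif, integral_map (by fun_prop) (measurable_tensorPow hf).aestronglyMeasurable,
    unitSphereUnif, integral_smul_measure, ENNReal.toReal_inv]
  rfl

/-- The density of the law of `v₁² + ⋯ + v_N²` under `f^{⊗N}`. -/
def energyDensity (N : ℕ) (f : ℝ → ℝ) (s : ℝ) : ℝ :=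
  if 0 < s then 1 / 2 * √s ^ (N - 2) * sphereInt N f √s else 0

theorem energyDensity_sq {N : ℕ} {f : ℝ → ℝ} {r : ℝ} (hr : 0 < r) :
    energyDensity N f (r ^ 2) = 1 / 2 * r ^ (N - 2) * sphereInt N f r := by
  rw [energyDensity, if_pos (by positivity), Real.sqrt_sq hr.le]

theorem sphereInt_nonneg {N : ℕ} {f : ℝ → ℝ} (hf0 : ∀ v, 0 ≤ f v) (r : ℝ) :
    0 ≤ sphereInt N f r :=
  integral_nonneg fun _ => Finset.prod_nonneg fun _ _ => hf0 _

theorem energyDensity_nonneg {N : ℕ} {f : ℝ → ℝ} (hf0 : ∀ v, 0 ≤ f v) (s : ℝ) :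
    0 ≤ energyDensity N f s := by
  unfold energyDensity
  split_ifs
  · exact mul_nonneg (by positivity) (sphereInt_nonneg hf0 _)
  · exact le_rfl

/-- The powers of `r = √s` cancel in `r^(N-2) · r² / r^N`, so the bound does not depend on `s`. -/
theorem energyDensity_le {N : ℕ} (hN : 3 ≤ N) {f : ℝ → ℝ} (hf : Measurable f) {q : ℝ}
    (hq : q = N / (N - 2)) (hfq : eLpNorm f (ENNReal.ofReal q) volume < ∞) (s : ℝ) :
    energyDensity N f s ≤ 3 * Real.pi / 2 * (eLpNorm f (ENNReal.ofReal q) volume).toReal ^ N := by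
  unfold energyDensity
  split_ifs with hs
  · have hr : 0 < √s := Real.sqrt_pos.2 hs
    have h1 := (le_abs_self _).trans (abs_sphereInt_le hN hf hq hfq hr)
    have h2 : √s ^ N = √s ^ (N - 2) * √s ^ 2 := by rw [← pow_add]; congr 1; omega
    calc 1 / 2 * √s ^ (N - 2) * sphereInt N f √s
        ≤ 1 / 2 * √s ^ (N - 2) * (3 * Real.pi * (√s ^ 2 / √s ^ N) *
          (eLpNorm f (ENNReal.ofReal q) volume).toReal ^ N) := by gcongr
      _ = _ := by
        rw [h2]
        field_simp
  · positivity

theorem continuousAt_energyDensity {N : ℕ} (hN : 3 ≤ N) {f : ℝ → ℝ} (hf : Measurable f) {q : ℝ}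
    (hq : q = N / (N - 2)) (hfq : eLpNorm f (ENNReal.ofReal q) volume < ∞) {s : ℝ} (hs : 0 < s) :
    ContinuousAt (energyDensity N f) s := by
  have h1 : ContinuousAt (fun s : ℝ => 1 / 2 * √s ^ (N - 2) * sphereInt N f √s) s := by
    have h2 : ContinuousAt (sphereInt N f) √s :=
      (continuousOn_sphereInt hN hf hq hfq).continuousAt (Ioi_mem_nhds (Real.sqrt_pos.2 hs))
    have h3 : ContinuousAt (fun s => sphereInt N f √s) s :=
      ContinuousAt.comp (f := fun s => √s) h2 (by fun_prop)
    exact (by fun_prop : ContinuousAt (fun s : ℝ => 1 / 2 * √s ^ (N - 2)) s).mul h3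
  refine h1.congr ?_
  filter_upwards [Ioi_mem_nhds hs] with u hu
  have hu : 0 < u := hu
  simp [energyDensity, hu]

theorem measurable_energyDensity {N : ℕ} {f : ℝ → ℝ} (hf : Measurable f) :
    Measurable (energyDensity N f) := by
  have h1 : Measurable (sphereInt N f) := by
    have : StronglyMeasurable fun p : ℝ × Metric.sphere (0 : EuclideanSpace ℝ (Fin N)) 1 =>
        ∏ j, f ((p.1 • (p.2 : EuclideanSpace ℝ (Fin N))).ofLp j) :=
      (Finset.measurable_fun_prod _ fun j _ => hf.comp (by fun_prop)).stronglyMeasurable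
    exact this.integral_prod_right.measurable
  refine Measurable.ite measurableSet_Ioi ?_ measurable_const
  exact (by fun_prop : Measurable fun s : ℝ => 1 / 2 * √s ^ (N - 2)).mul
    (h1.comp (by fun_prop))

/-- This identifies `energyDensity` as the density of the energy: polar coordinates, then `s = ρ²`,
for which `ρ^(N-1) dρ = s^((N-2)/2) ds / 2`. -/
theorem lintegral_prod_mul_sum_sq {N : ℕ} (hN : 3 ≤ N) {f : ℝ → ℝ} (hf : Measurable f)
    (hf0 : ∀ v, 0 ≤ f v) {q : ℝ} (hq : q = N / (N - 2))
    (hfq : eLpNorm f (ENNReal.ofReal q) volume < ∞) {g : ℝ → ℝ≥0∞} (hg : Measurable g) :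
    ∫⁻ x : Fin N → ℝ, (∏ j, ENNReal.ofReal (f (x j))) * g (∑ j, x j ^ 2)
      = ∫⁻ s, ENNReal.ofReal (energyDensity N f s) * g s := by
  have hm : Measurable fun x : Fin N → ℝ =>
      (∏ j, ENNReal.ofReal (f (x j))) * g (∑ j, x j ^ 2) :=
    (Finset.measurable_fun_prod _ fun j _ => (hf.comp (measurable_pi_apply j)).ennreal_ofReal).mul
      (hg.comp (by fun_prop))
  rw [lintegral_pi_eq_lintegral_surf (by omega) hm]
  have hinner : ∀ ρ ∈ Set.Ioi (0 : ℝ), ENNReal.ofReal (ρ ^ (N - 1)) *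
      ∫⁻ y, (∏ j, ENNReal.ofReal (f ((ρ • (y : EuclideanSpace ℝ (Fin N))).ofLp j))) *
        g (∑ j, (ρ • (y : EuclideanSpace ℝ (Fin N))).ofLp j ^ 2) ∂surf N
      = ENNReal.ofReal |2 * ρ| * (ENNReal.ofReal (energyDensity N f (ρ ^ 2)) * g (ρ ^ 2)) := by
    intro ρ hρ
    have hρ : 0 < ρ := hρ
    simp_rw [sum_sq_smul_sphere]
    rw [lintegral_mul_const]
    swap
    · exact Finset.measurable_fun_prod _ fun j _ => (hf.comp (by fun_prop)).ennreal_ofReal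
    have h1 : ∫⁻ y, (∏ j, ENNReal.ofReal (f ((ρ • (y : EuclideanSpace ℝ (Fin N))).ofLp j))) ∂surf N
        = ENNReal.ofReal (sphereInt N f ρ) := by
      rw [sphereInt, ofReal_integral_eq_lintegral_ofReal (integrable_surf_prod hN hf hq hfq hρ)
        (.of_forall fun y => Finset.prod_nonneg fun _ _ => hf0 _)]
      refine lintegral_congr fun y => ?_
      rw [ENNReal.ofReal_prod_of_nonneg fun _ _ => hf0 _]
    rw [h1, energyDensity_sq hρ, ← mul_assoc, ← mul_assoc, ← ENNReal.ofReal_mul (by positivity),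
      ← ENNReal.ofReal_mul (by positivity), abs_of_pos (by positivity)]
    congr 2
    have : ρ ^ (N - 1) = ρ * ρ ^ (N - 2) := by
      rw [← pow_succ']; congr 1; omega
    rw [this]
    ring
  rw [setLIntegral_congr_fun measurableSet_Ioi hinner,
    ← lintegral_image_eq_lintegral_abs_deriv_mul (f := fun ρ : ℝ => ρ ^ 2)
      (f' := fun ρ => 2 * ρ) measurableSet_Ioi (fun ρ _ => by
        simpa using (hasDerivAt_pow 2 ρ).hasDerivWithinAt) (fun a ha b hb hab =>
        (pow_left_inj₀ (le_of_lt ha) (le_of_lt hb) two_ne_zero).1 hab)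
      (fun s => ENNReal.ofReal (energyDensity N f s) * g s)]
  have himg : (fun ρ : ℝ => ρ ^ 2) '' Set.Ioi 0 = Set.Ioi 0 := by
    ext s
    constructor
    · rintro ⟨ρ, hρ, rfl⟩
      have hρ : 0 < ρ := hρ
      exact pow_pos hρ 2
    · intro hs
      exact ⟨√s, Real.sqrt_pos.2 hs, Real.sq_sqrt (le_of_lt hs)⟩
  rw [himg, ← lintegral_indicator measurableSet_Ioi]
  refine lintegral_congr fun s => ?_
  by_cases hs : 0 < s
  · rw [Set.indicator_of_mem (show s ∈ Set.Ioi (0 : ℝ) from hs)]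
  · rw [Set.indicator_of_notMem (show s ∉ Set.Ioi (0 : ℝ) from hs)]
    simp [energyDensity, hs]

theorem lintegral_energyDensity {N : ℕ} (hN : 3 ≤ N) {f : ℝ → ℝ} (hf : Measurable f)
    (hf0 : ∀ v, 0 ≤ f v) (hfi : Integrable f) (hf1 : ∫ v, f v = 1) {q : ℝ} (hq : q = N / (N - 2))
    (hfq : eLpNorm f (ENNReal.ofReal q) volume < ∞) :
    ∫⁻ s, ENNReal.ofReal (energyDensity N f s) = 1 := by
  have h1 := lintegral_prod_mul_sum_sq hN hf hf0 hq hfq (g := 1) measurable_one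
  simp only [Pi.one_apply, mul_one] at h1
  rw [← h1, lintegral_fintype_prod (F := fun _ u => ENNReal.ofReal (f u))
    (fun _ => hf.ennreal_ofReal)]
  rw [← ofReal_integral_eq_lintegral_ofReal hfi (.of_forall hf0), hf1]
  simp

theorem integrable_energyDensity {N : ℕ} (hN : 3 ≤ N) {f : ℝ → ℝ} (hf : Measurable f)
    (hf0 : ∀ v, 0 ≤ f v) (hfi : Integrable f) (hf1 : ∫ v, f v = 1) {q : ℝ} (hq : q = N / (N - 2))
    (hfq : eLpNorm f (ENNReal.ofReal q) volume < ∞) : Integrable (energyDensity N f) := by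
  refine ⟨(measurable_energyDensity hf).aestronglyMeasurable, ?_⟩
  rw [hasFiniteIntegral_iff_ofReal (.of_forall fun s => energyDensity_nonneg hf0 s),
    lintegral_energyDensity hN hf hf0 hfi hf1 hq hfq]
  simp

theorem integral_energyDensity {N : ℕ} (hN : 3 ≤ N) {f : ℝ → ℝ} (hf : Measurable f)
    (hf0 : ∀ v, 0 ≤ f v) (hfi : Integrable f) (hf1 : ∫ v, f v = 1) {q : ℝ} (hq : q = N / (N - 2))
    (hfq : eLpNorm f (ENNReal.ofReal q) volume < ∞) : ∫ s, energyDensity N f s = 1 := by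
  rw [integral_eq_lintegral_of_nonneg_ae (.of_forall fun s => energyDensity_nonneg hf0 s)
    (measurable_energyDensity hf).aestronglyMeasurable,
    lintegral_energyDensity hN hf hf0 hfi hf1 hq hfq]
  simp

/-- The characteristic function of `v²` when `v` has density `f`. -/
def charSq (f : ℝ → ℝ) (t : ℝ) : ℂ := ∫ v : ℝ, Complex.exp (Complex.I * (t * v ^ 2)) * f v

theorem integral_exp_mul_energyDensity {N : ℕ} (hN : 3 ≤ N) {f : ℝ → ℝ} (hf : Measurable f)
    (hf0 : ∀ v, 0 ≤ f v) {q : ℝ} (hq : q = N / (N - 2))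
    (hfq : eLpNorm f (ENNReal.ofReal q) volume < ∞) (t : ℝ) :
    ∫ s : ℝ, Complex.exp (Complex.I * (t * s)) * energyDensity N f s = charSq f t ^ N := by
  let ν : Measure (Fin N → ℝ) := volume.withDensity fun x => ∏ j, ENNReal.ofReal (f (x j))
  have hmprod : Measurable fun x : Fin N → ℝ => ∏ j, ENNReal.ofReal (f (x j)) :=
    Finset.measurable_fun_prod _ fun j _ => (hf.comp (measurable_pi_apply j)).ennreal_ofReal
  have hmS : Measurable fun x : Fin N → ℝ => ∑ j, x j ^ 2 := by fun_prop
  -- The image of the product law under the energy; its characteristic function factorizes by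
  -- independence.
  have hmap : ν.map (fun x => ∑ j, x j ^ 2)
      = volume.withDensity fun s => ENNReal.ofReal (energyDensity N f s) := by
    refine Measure.ext_of_lintegral _ fun g hg => ?_
    rw [lintegral_map hg hmS]
    refine (lintegral_withDensity_eq_lintegral_mul _ hmprod (hg.comp hmS)).trans ?_
    rw [lintegral_withDensity_eq_lintegral_mul _ (measurable_energyDensity hf).ennreal_ofReal hg]
    exact lintegral_prod_mul_sum_sq hN hf hf0 hq hfq hg
  have hG : Continuous fun s : ℝ => Complex.exp (Complex.I * (t * s)) := by fun_prop
  have h1 : ∫ s : ℝ, Complex.exp (Complex.I * (t * s)) * energyDensity N f s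
      = ∫ s : ℝ, Complex.exp (Complex.I * (t * s))
        ∂(volume.withDensity fun s => ENNReal.ofReal (energyDensity N f s)) := by
    rw [integral_withDensity_eq_integral_toReal_smul (measurable_energyDensity hf).ennreal_ofReal
      (.of_forall fun _ => by simp)]
    refine integral_congr_ae (.of_forall fun s => ?_)
    simp only [ENNReal.toReal_ofReal (energyDensity_nonneg hf0 s), Complex.real_smul]
    ring
  rw [h1, ← hmap, integral_map hmS.aemeasurable hG.aestronglyMeasurable,
    integral_withDensity_eq_integral_toReal_smul hmprod
      (.of_forall fun x => ENNReal.prod_lt_top fun _ _ => by simp), charSq]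
  have h2 := integral_fintype_prod_volume_eq_pow (ι := Fin N)
    (fun v : ℝ => Complex.exp (Complex.I * (t * v ^ 2)) * f v)
  rw [Fintype.card_fin] at h2
  rw [← h2]
  refine integral_congr_ae (.of_forall fun x => ?_)
  simp only [ENNReal.toReal_prod, ENNReal.toReal_ofReal (hf0 _), Complex.real_smul]
  rw [Finset.prod_mul_distrib, ← Complex.exp_sum, ← Finset.mul_sum, ← Finset.mul_sum, mul_comm]
  push_cast
  rfl

end CondTensor

end

/-! ### Fourier inversion and a Plancherel inequality -/

noncomputable section

namespace CondTensor

open scoped ENNReal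

open FourierTransform in
theorem fourier_inversion_exp {D : ℝ → ℝ} (hD : Integrable D) {ψ : ℝ → ℂ}
    (hψ : ∀ t : ℝ, ∫ s : ℝ, Complex.exp (Complex.I * (t * s)) * D s = ψ t) (hψi : Integrable ψ) {s : ℝ}
    (hs : ContinuousAt D s) :
    (D s : ℂ) = (1 / (2 * Real.pi) : ℝ) * ∫ t : ℝ, ψ t * Complex.exp (-(Complex.I * (t * s))) := by
  -- Change of convention: the transform `𝓕` uses the kernel `exp (-2πi ξ s)`. The rescaling by
  -- `-2π` is the source of the prefactor `1 / (2π)`.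
  have hF : ∀ ξ : ℝ, 𝓕 (fun s => (D s : ℂ)) ξ = ψ (-(2 * Real.pi) * ξ) := by
    intro ξ
    rw [Real.fourier_real_eq_integral_exp_smul, ← hψ]
    refine integral_congr_ae (.of_forall fun u => ?_)
    simp only [smul_eq_mul]
    congr 2
    push_cast
    ring
  have hne : -(2 * Real.pi) ≠ 0 := by simp [Real.pi_ne_zero]
  have hFi : Integrable (𝓕 (fun s => (D s : ℂ))) := by
    have : 𝓕 (fun s => (D s : ℂ)) = fun ξ => ψ (-(2 * Real.pi) * ξ) := funext hF
    rw [this]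
    exact hψi.comp_mul_left' hne
  have hinv := MeasureTheory.Integrable.fourierInv_fourier_eq (f := fun s => (D s : ℂ)) hD.ofReal
    hFi (v := s) (Complex.continuous_ofReal.continuousAt.comp hs)
  rw [Real.fourierInv_eq', ] at hinv
  rw [← hinv]
  have hsub := Measure.integral_comp_mul_left
    (fun t : ℝ => ψ t * Complex.exp (-(Complex.I * (t * s)))) (-(2 * Real.pi))
  have habs : |(-(2 * Real.pi))⁻¹| = 1 / (2 * Real.pi) := by
    rw [abs_inv, abs_neg, abs_of_pos (by positivity), one_div]
  rw [habs, Complex.real_smul] at hsub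
  rw [← hsub]
  refine integral_congr_ae (.of_forall fun ξ => ?_)
  simp only [hF, smul_eq_mul]
  rw [mul_comm]
  congr 2
  simp only [RCLike.inner_apply, conj_trivial]
  push_cast
  ring

/-- Writing `|φ|²` as a double integral and integrating in `t` first leaves `D(s) D(u)` against a
Gaussian kernel in `s - u` whose mass is `2π` whatever `c` is. One copy of `D` is bounded by `M`,
the other integrates to `1`. The Gaussian weight makes Fubini legitimate. -/
theorem integral_gaussian_mul_norm_sq_le {D : ℝ → ℝ} (hD : Integrable D) (hD0 : ∀ s, 0 ≤ D s)
    (hD1 : ∫ s, D s = 1) {M : ℝ} (hM : ∀ s, D s ≤ M) {c : ℝ} (hc : 0 < c) :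
    ∫ t : ℝ, Real.exp (-c * t ^ 2) * ‖∫ s : ℝ, Complex.exp (Complex.I * (t * s)) * D s‖ ^ 2
      ≤ 2 * Real.pi * M := by
  set φ : ℝ → ℂ := fun t => ∫ s : ℝ, Complex.exp (Complex.I * (t * s)) * D s with hφ
  let F : ℝ → ℝ × ℝ → ℂ := fun t p =>
    Complex.exp (-c * t ^ 2) * (Complex.exp (Complex.I * (t * p.1)) * D p.1 *
      (Complex.exp (-(Complex.I * (t * p.2))) * D p.2))
  have hsq : ∀ t : ℝ, ((Real.exp (-c * t ^ 2) * ‖φ t‖ ^ 2 : ℝ) : ℂ) = ∫ p, F t p := by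
    intro t
    simp only [F]
    rw [integral_const_mul, Measure.volume_eq_prod, integral_prod_mul
      (fun s : ℝ => Complex.exp (Complex.I * (t * s)) * D s)
      (fun s : ℝ => Complex.exp (-(Complex.I * (t * s))) * D s)]
    have hconj : ∫ s : ℝ, Complex.exp (-(Complex.I * (t * s))) * D s
        = (starRingEnd ℂ) (φ t) := by
      simp only [hφ]
      rw [← integral_conj]
      refine integral_congr_ae (.of_forall fun s => ?_)
      simp [← Complex.exp_conj]
    rw [hconj, Complex.mul_conj, Complex.normSq_eq_norm_sq]
    push_cast
    rfl
  have hDD : Integrable fun p : ℝ × ℝ => D p.1 * D p.2 := by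
    rw [Measure.volume_eq_prod]
    exact hD.mul_prod hD
  have hg : Integrable fun t : ℝ => Real.exp (-c * t ^ 2) := integrable_exp_neg_mul_sq hc
  have hFn : ∀ t p, ‖F t p‖ = Real.exp (-c * t ^ 2) * (D p.1 * D p.2) := by
    intro t p
    have e1 : ‖Complex.exp (-c * t ^ 2)‖ = Real.exp (-c * t ^ 2) := by
      rw [Complex.norm_exp]; congr 1; norm_cast
    have e2 : ∀ x : ℝ, ‖Complex.exp (Complex.I * (t * x))‖ = 1 := by
      intro x
      rw [Complex.norm_exp]; simp
    have e3 : ∀ x : ℝ, ‖Complex.exp (-(Complex.I * (t * x)))‖ = 1 := by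
      intro x
      rw [Complex.norm_exp]; simp
    simp only [F, norm_mul, e1, e2, e3, one_mul, Complex.norm_real, Real.norm_eq_abs,
      abs_of_nonneg (hD0 _)]
  have hFi : Integrable (Function.uncurry F) (volume.prod volume) := by
    refine Integrable.mono' (hg.mul_prod hDD) ?_ (.of_forall fun q => (hFn q.1 q.2).le)
    have hDm := hD.aestronglyMeasurable
    simp only [F, Function.uncurry_def]
    have h1 : AEStronglyMeasurable (fun q : ℝ × ℝ × ℝ => (D q.2.1 : ℂ))
        (volume.prod (volume : Measure (ℝ × ℝ))) :=
      Complex.continuous_ofReal.comp_aestronglyMeasurable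
        ((hDm.comp_fst (ν := (volume : Measure ℝ))).comp_snd)
    have h2 : AEStronglyMeasurable (fun q : ℝ × ℝ × ℝ => (D q.2.2 : ℂ))
        (volume.prod (volume : Measure (ℝ × ℝ))) :=
      Complex.continuous_ofReal.comp_aestronglyMeasurable
        ((hDm.comp_snd (μ := (volume : Measure ℝ))).comp_snd)
    refine AEStronglyMeasurable.mul (by fun_prop) (AEStronglyMeasurable.mul ?_ ?_)
    · exact AEStronglyMeasurable.mul (by fun_prop) h1
    · exact AEStronglyMeasurable.mul (by fun_prop) h2
  have hinner : ∀ p : ℝ × ℝ, ‖∫ t, F t p‖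
      = D p.1 * D p.2 * (√(Real.pi / c) * Real.exp (-(p.1 - p.2) ^ 2 / (4 * c))) := by
    intro p
    have h1 : ∀ t, F t p = (D p.1 * D p.2 : ℂ) *
        (Complex.exp (Complex.I * (p.1 - p.2 : ℝ) * t) * Complex.exp (-(c : ℂ) * t ^ 2)) := by
      intro t
      have : Complex.exp (Complex.I * (p.1 - p.2 : ℝ) * t)
          = Complex.exp (Complex.I * (t * p.1)) * Complex.exp (-(Complex.I * (t * p.2))) := by
        rw [← Complex.exp_add]; congr 1; push_cast; ring
      simp only [F, this]
      ring
    simp_rw [h1]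
    rw [integral_const_mul, fourierIntegral_gaussian (by simpa using hc)]
    have h2 : ((Real.pi : ℂ) / c) ^ (1 / 2 : ℂ) = (√(Real.pi / c) : ℝ) := by
      rw [Real.sqrt_eq_rpow, Complex.ofReal_cpow (by positivity)]
      push_cast; rfl
    have h3 : Complex.exp (-((p.1 - p.2 : ℝ) : ℂ) ^ 2 / (4 * c))
        = (Real.exp (-(p.1 - p.2) ^ 2 / (4 * c)) : ℝ) := by
      push_cast; rfl
    rw [h2, h3]
    simp only [norm_mul, Complex.norm_real, Real.norm_eq_abs, abs_of_nonneg (hD0 _),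
      abs_of_nonneg (Real.sqrt_nonneg _), abs_of_pos (Real.exp_pos _)]
  have hM0 : 0 ≤ M := (hD0 0).trans (hM 0)
  have hgc : Integrable fun x : ℝ => √(Real.pi / c) * Real.exp (-x ^ 2 / (4 * c)) := by
    have := (integrable_exp_neg_mul_sq (b := 1 / (4 * c)) (by positivity)).const_mul √(Real.pi / c)
    refine this.congr (.of_forall fun x => ?_)
    simp only
    congr 2
    ring
  have hgci : ∫ x : ℝ, √(Real.pi / c) * Real.exp (-x ^ 2 / (4 * c)) = 2 * Real.pi := by
    rw [integral_const_mul]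
    have h1 : ∀ x : ℝ, -x ^ 2 / (4 * c) = -(1 / (4 * c)) * x ^ 2 := fun x => by ring
    simp_rw [h1]
    rw [integral_gaussian, ← Real.sqrt_mul (by positivity)]
    rw [show Real.pi / c * (Real.pi / (1 / (4 * c))) = (2 * Real.pi) ^ 2 by field_simp; ring]
    exact Real.sqrt_sq (by positivity)
  have hKi : Integrable fun p : ℝ × ℝ =>
      D p.1 * D p.2 * (√(Real.pi / c) * Real.exp (-(p.1 - p.2) ^ 2 / (4 * c))) := by
    have := hFi.integral_prod_right.norm
    refine this.congr (.of_forall fun p => ?_)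
    exact hinner p
  calc ∫ t : ℝ, Real.exp (-c * t ^ 2) * ‖φ t‖ ^ 2
      ≤ ‖((∫ t : ℝ, Real.exp (-c * t ^ 2) * ‖φ t‖ ^ 2 : ℝ) : ℂ)‖ := by
        rw [Complex.norm_real]; exact Real.le_norm_self _
    _ = ‖∫ p, ∫ t, F t p‖ := by
        rw [← integral_complex_ofReal, integral_congr_ae (.of_forall hsq),
          integral_integral_swap hFi]
    _ ≤ ∫ p, ‖∫ t, F t p‖ := norm_integral_le_integral_norm _
    _ = ∫ p : ℝ × ℝ, D p.1 * D p.2 * (√(Real.pi / c) * Real.exp (-(p.1 - p.2) ^ 2 / (4 * c))) :=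
        integral_congr_ae (.of_forall hinner)
    _ = ∫ s, ∫ u, D s * D u * (√(Real.pi / c) * Real.exp (-(s - u) ^ 2 / (4 * c))) := by
        rw [Measure.volume_eq_prod] at hKi ⊢
        exact integral_prod _ hKi
    _ ≤ ∫ s, D s * (M * (2 * Real.pi)) := by
        rw [Measure.volume_eq_prod] at hKi
        refine integral_mono_ae hKi.integral_prod_left (hD.mul_const _) ?_
        filter_upwards [hKi.prod_right_ae] with s hs
        have hshift : ∫ u, √(Real.pi / c) * Real.exp (-(s - u) ^ 2 / (4 * c)) = 2 * Real.pi := by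
          rw [← hgci]
          exact integral_sub_left_eq_self
            (fun x => √(Real.pi / c) * Real.exp (-x ^ 2 / (4 * c))) volume s
        have hshifti : Integrable fun u => √(Real.pi / c) * Real.exp (-(s - u) ^ 2 / (4 * c)) :=
          hgc.comp_sub_left s
        calc ∫ u, D s * D u * (√(Real.pi / c) * Real.exp (-(s - u) ^ 2 / (4 * c)))
            ≤ ∫ u, D s * M * (√(Real.pi / c) * Real.exp (-(s - u) ^ 2 / (4 * c))) := by
              refine integral_mono hs (hshifti.const_mul _) fun u => ?_
              have := hD0 s
              have := hM u
              simp only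
              gcongr
          _ = D s * (M * (2 * Real.pi)) := by
              rw [integral_const_mul, hshift]; ring
    _ = 2 * Real.pi * M := by
        rw [integral_mul_const, hD1]; ring

/-- Fatou's lemma as the Gaussian regularization is removed, `c = 1 / (n + 1) → 0`. In particular a
bounded density has a square-integrable characteristic function. -/
theorem lintegral_enorm_sq_le {D : ℝ → ℝ} (hD : Integrable D) (hD0 : ∀ s, 0 ≤ D s)
    (hD1 : ∫ s, D s = 1) {M : ℝ} (hM : ∀ s, D s ≤ M) {φ : ℝ → ℂ} (hφc : Continuous φ)
    (hφ : ∀ t : ℝ, ∫ s : ℝ, Complex.exp (Complex.I * (t * s)) * D s = φ t) :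
    ∫⁻ t, ENNReal.ofReal (‖φ t‖ ^ 2) ≤ ENNReal.ofReal (2 * Real.pi * M) := by
  have hφ1 : ∀ t, ‖φ t‖ ≤ 1 := by
    intro t
    rw [← hφ, ← hD1]
    refine (norm_integral_le_integral_norm _).trans (le_of_eq ?_)
    refine integral_congr_ae (.of_forall fun s => ?_)
    simp [Complex.norm_exp, abs_of_nonneg (hD0 s)]
  let G : ℕ → ℝ → ℝ≥0∞ := fun n t =>
    ENNReal.ofReal (Real.exp (-(1 / ((n : ℝ) + 1)) * t ^ 2) * ‖φ t‖ ^ 2)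
  have hG : ∀ n, Measurable (G n) := fun n => by
    refine Measurable.ennreal_ofReal ?_
    have := hφc.measurable
    fun_prop
  have hlim : ∀ t, liminf (fun n => G n t) atTop = ENNReal.ofReal (‖φ t‖ ^ 2) := by
    intro t
    refine Tendsto.liminf_eq ?_
    refine ENNReal.tendsto_ofReal ?_
    have h1 : Tendsto (fun n : ℕ => Real.exp (-(1 / ((n : ℝ) + 1)) * t ^ 2) * ‖φ t‖ ^ 2) atTop
        (𝓝 (Real.exp (-0 * t ^ 2) * ‖φ t‖ ^ 2)) := by
      refine Tendsto.mul_const _ ?_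
      refine (Real.continuous_exp.tendsto _).comp ?_
      exact (tendsto_one_div_add_atTop_nhds_zero_nat.neg).mul_const _
    simpa using h1
  calc ∫⁻ t, ENNReal.ofReal (‖φ t‖ ^ 2) = ∫⁻ t, liminf (fun n => G n t) atTop := by
        simp_rw [hlim]
    _ ≤ liminf (fun n => ∫⁻ t, G n t) atTop := lintegral_liminf_le hG
    _ ≤ ENNReal.ofReal (2 * Real.pi * M) := by
        refine liminf_le_of_frequently_le' (Frequently.of_forall fun n => ?_)
        have hc : 0 < 1 / ((n : ℝ) + 1) := by positivity
        have h1 := integral_gaussian_mul_norm_sq_le hD hD0 hD1 hM hc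
        simp_rw [hφ] at h1
        have hi : Integrable fun t : ℝ => Real.exp (-(1 / ((n : ℝ) + 1)) * t ^ 2) * ‖φ t‖ ^ 2 := by
          refine Integrable.mono' (integrable_exp_neg_mul_sq hc)
            (by fun_prop) (.of_forall fun t => ?_)
          rw [Real.norm_of_nonneg (by positivity)]
          exact mul_le_of_le_one_right (Real.exp_pos _).le (pow_le_one₀ (norm_nonneg _) (hφ1 t))
        simp only [G]
        rw [← ofReal_integral_eq_lintegral_ofReal hi (.of_forall fun t => by positivity)]
        exact ENNReal.ofReal_le_ofReal h1

end CondTensor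

end

/-! ### Characteristic function of `v²` and the uniform Cramér condition -/

noncomputable section

namespace CondTensor

open scoped ENNReal

/-- Measurable nonnegative densities with uniformly controlled energy, energy deviation, `L^p` norm
and fourth-moment tails. -/
structure TameDensity (p Emax Smin L : ℝ) (χ : ℝ → ℝ) (f : ℝ → ℝ) : Prop where
  measurable : Measurable f
  nonneg : ∀ v, 0 ≤ f v
  integrable : Integrable f
  integral_eq_one : ∫ v, f v = 1
  integrable_pow_four : Integrable fun v => f v * v ^ 4
  energy_le : energy f ≤ Emax
  le_energyDev : Smin ≤ energyDev f
  eLpNorm_le : eLpNorm f (ENNReal.ofReal p) volume ≤ ENNReal.ofReal L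
  tail_le : ∀ r > 0, (∫ v in {v : ℝ | 1 / r ≤ |v|}, f v * v ^ 4) ≤ χ r

section Basic

variable {f : ℝ → ℝ}

theorem continuous_charSq (hfi : Integrable f) : Continuous (charSq f) := by
  refine continuous_of_dominated (bound := fun v => ‖f v‖) ?_ ?_ hfi.norm ?_
  · intro t
    exact AEStronglyMeasurable.mul (by fun_prop)
      (Complex.continuous_ofReal.comp_aestronglyMeasurable hfi.aestronglyMeasurable)
  · intro t
    refine .of_forall fun v => ?_
    rw [norm_mul, Complex.norm_real]
    simp [Complex.norm_exp, ← Complex.ofReal_pow]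
  · exact .of_forall fun v => by fun_prop

theorem integrable_charSq_integrand (hfi : Integrable f) (t : ℝ) :
    Integrable fun v : ℝ => Complex.exp (Complex.I * (t * v ^ 2)) * f v := by
  refine Integrable.mono' hfi.norm (AEStronglyMeasurable.mul (by fun_prop)
      (Complex.continuous_ofReal.comp_aestronglyMeasurable hfi.aestronglyMeasurable))
      (.of_forall fun v => ?_)
  rw [norm_mul, Complex.norm_real]
  simp [Complex.norm_exp, ← Complex.ofReal_pow]

theorem norm_charSq_le_one (hf0 : ∀ v, 0 ≤ f v) (hf1 : ∫ v, f v = 1) (t : ℝ) :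
    ‖charSq f t‖ ≤ 1 := by
  rw [← hf1]
  refine (norm_integral_le_integral_norm _).trans (le_of_eq ?_)
  refine integral_congr_ae (.of_forall fun v => ?_)
  simp [Complex.norm_exp, ← Complex.ofReal_pow, abs_of_nonneg (hf0 v)]

theorem norm_charSq_sub_le (hf0 : ∀ v, 0 ≤ f v) (hfi : Integrable f)
    (hf2 : Integrable fun v => f v * v ^ 2) (t s : ℝ) :
    ‖charSq f t - charSq f s‖ ≤ |t - s| * energy f := by
  rw [charSq, charSq, ← integral_sub (integrable_charSq_integrand hfi t)
    (integrable_charSq_integrand hfi s), energy, ← integral_const_mul]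
  refine norm_integral_le_of_norm_le (hf2.const_mul _) (.of_forall fun v => ?_)
  have h1 : Complex.exp (Complex.I * (t * v ^ 2)) * f v - Complex.exp (Complex.I * (s * v ^ 2)) * f v
      = Complex.exp (Complex.I * (s * v ^ 2)) *
        ((Complex.exp (Complex.I * ((t - s) * v ^ 2 : ℝ)) - 1) * f v) := by
    have : Complex.exp (Complex.I * (t * v ^ 2)) = Complex.exp (Complex.I * (s * v ^ 2)) *
        Complex.exp (Complex.I * ((t - s) * v ^ 2 : ℝ)) := by
      rw [← Complex.exp_add]; congr 1; push_cast; ring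
    rw [this]; ring
  have h2 : ‖Complex.exp (Complex.I * (s * v ^ 2))‖ = 1 := by
    simp [Complex.norm_exp, ← Complex.ofReal_pow]
  rw [h1, norm_mul, h2, one_mul, norm_mul, Complex.norm_real, Real.norm_of_nonneg (hf0 v)]
  have h3 := Real.norm_exp_I_mul_ofReal_sub_one_le (x := (t - s) * v ^ 2)
  rw [Real.norm_eq_abs, abs_mul, abs_of_nonneg (sq_nonneg v)] at h3
  calc _ ≤ |t - s| * v ^ 2 * f v := by
        have := hf0 v
        gcongr
    _ = _ := by ring

/-- Equivalent, by the half-angle formula, to `|sin (k y)| ≤ k |sin y|`. -/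
theorem one_sub_cos_nat_mul_le (k : ℕ) (x : ℝ) :
    1 - Real.cos (k * x) ≤ k ^ 2 * (1 - Real.cos x) := by
  have h1 : ∀ n : ℕ, |Real.sin (n * (x / 2))| ≤ n * |Real.sin (x / 2)| := by
    intro n
    induction n with
    | zero => simp
    | succ n ih =>
      push_cast
      rw [add_mul, one_mul, Real.sin_add]
      calc _ ≤ |Real.sin (n * (x / 2)) * Real.cos (x / 2)|
            + |Real.cos (n * (x / 2)) * Real.sin (x / 2)| := abs_add_le _ _
        _ ≤ |Real.sin (n * (x / 2))| * 1 + 1 * |Real.sin (x / 2)| := by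
            rw [abs_mul, abs_mul]
            gcongr
            · exact Real.abs_cos_le_one _
            · exact Real.abs_cos_le_one _
        _ ≤ _ := by linarith
  have h2 : ∀ y : ℝ, 1 - Real.cos y = 2 * |Real.sin (y / 2)| ^ 2 := by
    intro y
    rw [sq_abs, Real.sin_sq_eq_half_sub, mul_div_cancel₀ _ two_ne_zero]; ring
  rw [h2, h2, show k * x / 2 = k * (x / 2) by ring]
  have h3 := h1 k
  calc _ ≤ 2 * (k * |Real.sin (x / 2)|) ^ 2 := by gcongr
    _ = _ := by ring

theorem re_exp_mul_charSq (hfi : Integrable f) (t θ : ℝ) :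
    (Complex.exp (-(Complex.I * θ)) * charSq f t).re = ∫ v, Real.cos (t * v ^ 2 - θ) * f v := by
  rw [charSq, ← integral_const_mul, ← Complex.reCLM_apply, ← ContinuousLinearMap.integral_comp_comm _
    ((integrable_charSq_integrand hfi t).const_mul _)]
  refine integral_congr_ae (.of_forall fun v => ?_)
  have : Complex.exp (-(Complex.I * θ)) * (Complex.exp (Complex.I * (t * v ^ 2)) * f v)
      = Complex.exp ((t * v ^ 2 - θ : ℝ) * Complex.I) * f v := by
    rw [← mul_assoc, ← Complex.exp_add]; congr 2; push_cast; ring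
  simp only [this, Complex.reCLM_apply, Complex.re_mul_ofReal, Complex.exp_ofReal_mul_I_re]

/-- A modulus near `1` at `t` means that `t v²` is concentrated near one phase `θ` modulo `2π`; then
`k t v²` is concentrated near `k θ`, with a loss of at most `k²`. Thus near-maximal modulus
propagates to multiples of `t`. -/
theorem one_sub_sq_mul_le_norm_charSq (hf0 : ∀ v, 0 ≤ f v) (hfi : Integrable f)
    (hf1 : ∫ v, f v = 1) (k : ℕ) (t : ℝ) :
    1 - k ^ 2 * (1 - ‖charSq f t‖) ≤ ‖charSq f (k * t)‖ := by
  set θ := (charSq f t).arg with hθ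
  have hcos : ∀ a b : ℝ, Integrable fun v => Real.cos (a * v ^ 2 - b) * f v := by
    intro a b
    refine Integrable.mono' hfi.norm (AEStronglyMeasurable.mul (by fun_prop)
      hfi.aestronglyMeasurable) (.of_forall fun v => ?_)
    rw [norm_mul]
    exact mul_le_of_le_one_left (norm_nonneg _) (Real.abs_cos_le_one _)
  have h1 : ‖charSq f t‖ = ∫ v, Real.cos (t * v ^ 2 - θ) * f v := by
    rw [← re_exp_mul_charSq hfi]
    have h2 := Complex.norm_mul_exp_arg_mul_I (charSq f t)
    rw [← hθ] at h2
    have h3 : Complex.exp (-(Complex.I * θ)) * charSq f t = ‖charSq f t‖ := by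
      conv_lhs => rw [← h2]
      rw [mul_left_comm, ← Complex.exp_add]
      simp [mul_comm]
    rw [h3, Complex.ofReal_re]
  have h4 : ∫ v, Real.cos (k * t * v ^ 2 - k * θ) * f v ≤ ‖charSq f (k * t)‖ := by
    have := re_exp_mul_charSq hfi (k * t) (k * θ)
    rw [← this]
    refine (Complex.re_le_norm _).trans (le_of_eq ?_)
    rw [norm_mul, show ‖Complex.exp (-(Complex.I * ((k * θ : ℝ) : ℂ)))‖ = 1 by
      simp [Complex.norm_exp], one_mul]
  refine le_trans ?_ h4
  have h5 : 1 - (k : ℝ) ^ 2 * (1 - ‖charSq f t‖)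
      = ∫ v, (f v - k ^ 2 * (f v - Real.cos (t * v ^ 2 - θ) * f v)) := by
    have h8 : Integrable fun v => f v - Real.cos (t * v ^ 2 - θ) * f v := hfi.sub (hcos _ _)
    rw [integral_sub hfi (h8.const_mul _), integral_const_mul,
      integral_sub hfi (hcos _ _), ← h1, hf1]
  rw [h5]
  refine integral_mono (hfi.sub ((hfi.sub (hcos _ _)).const_mul _)) (hcos _ _) fun v => ?_
  have h6 := one_sub_cos_nat_mul_le k (t * v ^ 2 - θ)
  have h7 : (k : ℝ) * t * v ^ 2 - k * θ = k * (t * v ^ 2 - θ) := by ring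
  simp only [h7]
  nlinarith [hf0 v, mul_le_mul_of_nonneg_right h6 (hf0 v)]

/-- A density whose characteristic function (of `v²`) has a bounded `2m`-th moment and which has
bounded energy satisfies Cramér's condition uniformly. -/
theorem exists_norm_charSq_le (m : ℕ) (C Emax δ : ℝ) (hδ : 0 < δ) :
    ∃ κ : ℝ, 0 < κ ∧ κ < 1 ∧ ∀ f : ℝ → ℝ, (∀ v, 0 ≤ f v) → Integrable f → ∫ v, f v = 1 →
      Integrable (fun v => f v * v ^ 2) → energy f ≤ Emax →
      ∫⁻ t, ENNReal.ofReal (‖charSq f t‖ ^ (2 * m)) ≤ ENNReal.ofReal C →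
      ∀ t : ℝ, δ ≤ |t| → ‖charSq f t‖ ≤ 1 - κ := by
  -- The first bound makes the balls of radius `a` about multiples of `t` disjoint when `|t| ≥ δ`;
  -- the second limits the variation of the characteristic function on each ball to `1 / 4`.
  set a : ℝ := min (δ / 2) (1 / (4 * (|Emax| + 1))) with ha
  have ha0 : 0 < a := by positivity
  have haδ : 2 * a ≤ δ := by linarith [min_le_left (δ / 2) (1 / (4 * (|Emax| + 1)))]
  have haE : a * Emax ≤ 1 / 4 := by
    have h1 : a ≤ 1 / (4 * (|Emax| + 1)) := min_le_right _ _
    calc a * Emax ≤ a * (|Emax| + 1) := by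
          gcongr; linarith [le_abs_self Emax]
      _ ≤ 1 / (4 * (|Emax| + 1)) * (|Emax| + 1) := by gcongr
      _ = 1 / 4 := by field_simp
  -- `K` disjoint balls of length `2 a` on which the modulus is at least `1 / 2` would exceed the
  -- available integral `C`.
  obtain ⟨K, hK⟩ := exists_nat_gt (|C| / (2 * a * (1 / 2) ^ (2 * m)))
  have hK0 : (0 : ℝ) < K := lt_of_le_of_lt (by positivity) hK
  rw [div_lt_iff₀ (by positivity)] at hK
  -- If the modulus at `t` exceeded `1 - κ`, the loss `k² κ ≤ 1 / 4` for `k ≤ K` would leave modulus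
  -- at least `3 / 4` at `k t`.
  refine ⟨min (1 / 2) (1 / (4 * K ^ 2)), by positivity,
    (min_le_left _ _).trans_lt (by norm_num), ?_⟩
  intro f hf0 hfi hf1 hf2 hE hC t ht
  by_contra! hlt
  set κ := min (1 / 2 : ℝ) (1 / (4 * K ^ 2)) with hκ
  have hbig : ∀ k ∈ Finset.Icc 1 K, ∀ s ∈ Metric.ball ((k : ℝ) * t) a, 1 / 2 ≤ ‖charSq f s‖ := by
    intro k hk s hs
    have hkK : (k : ℝ) ≤ K := by exact_mod_cast (Finset.mem_Icc.1 hk).2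
    have h1 := one_sub_sq_mul_le_norm_charSq hf0 hfi hf1 k t
    have h2 : (k : ℝ) ^ 2 * (1 - ‖charSq f t‖) ≤ 1 / 4 := by
      have : 1 - ‖charSq f t‖ ≤ 1 / (4 * K ^ 2) := by
        linarith [min_le_right (1 / 2 : ℝ) (1 / (4 * K ^ 2))]
      calc (k : ℝ) ^ 2 * (1 - ‖charSq f t‖) ≤ (k : ℝ) ^ 2 * (1 / (4 * K ^ 2)) := by gcongr
        _ ≤ (K : ℝ) ^ 2 * (1 / (4 * K ^ 2)) := by gcongr
        _ = 1 / 4 := by field_simp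
    have h3 := norm_charSq_sub_le hf0 hfi hf2 (k * t) s
    have h4 : |k * t - s| * energy f ≤ 1 / 4 := by
      have hE0 : 0 ≤ energy f := integral_nonneg fun v => mul_nonneg (hf0 v) (sq_nonneg v)
      rw [Metric.mem_ball, Real.dist_eq, abs_sub_comm] at hs
      calc _ ≤ a * Emax := by gcongr
        _ ≤ _ := haE
    have h5 := norm_sub_norm_le (charSq f (k * t)) (charSq f s)
    linarith
  have hdisj : Set.PairwiseDisjoint (↑(Finset.Icc 1 K)) fun k : ℕ => Metric.ball ((k : ℝ) * t) a := by
    intro k _ l _ hkl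
    refine Metric.ball_disjoint_ball ?_
    rw [Real.dist_eq, ← sub_mul, abs_mul]
    have : (1 : ℝ) ≤ |(k : ℝ) - l| := by
      have h : (1 : ℤ) ≤ |(k : ℤ) - l| := Int.one_le_abs (by omega)
      exact_mod_cast h
    nlinarith [abs_nonneg t]
  have hvol : volume (⋃ k ∈ Finset.Icc 1 K, Metric.ball ((k : ℝ) * t) a)
      = ENNReal.ofReal (K * (2 * a)) := by
    rw [measure_biUnion_finset hdisj fun _ _ => Metric.isOpen_ball.measurableSet]
    simp only [Real.volume_ball, Finset.sum_const, Nat.card_Icc, Nat.add_sub_cancel]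
    rw [nsmul_eq_mul, ENNReal.ofReal_mul hK0.le, ENNReal.ofReal_natCast]
  have hlow : ENNReal.ofReal ((1 / 2) ^ (2 * m)) * ENNReal.ofReal (K * (2 * a))
      ≤ ENNReal.ofReal C := by
    refine le_trans ?_ hC
    rw [← hvol, ← setLIntegral_const]
    refine (setLIntegral_mono_ae' ?_ (.of_forall fun s hs => ?_)).trans
      (setLIntegral_le_lintegral _ _)
    · exact (Finset.Icc 1 K).measurableSet_biUnion fun _ _ => Metric.isOpen_ball.measurableSet
    · obtain ⟨k, hk, hs⟩ := Set.mem_iUnion₂.1 hs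
      refine ENNReal.ofReal_le_ofReal ?_
      exact pow_le_pow_left₀ (by norm_num) (hbig k hk s hs) _
  rw [← ENNReal.ofReal_mul (by positivity)] at hlow
  have hpos : 0 < (1 / 2 : ℝ) ^ (2 * m) * (K * (2 * a)) := by positivity
  have hfin := (ENNReal.ofReal_le_ofReal_iff'.1 hlow).resolve_right (not_le.2 hpos)
  have := le_abs_self C
  nlinarith

/-- The quadratic bound serves the tail, where only fourth moments are available; the cubic one
gives the small factor `|t|` for bounded velocities. -/
theorem norm_exp_I_mul_sub_taylor_le (x : ℝ) :
    ‖Complex.exp (Complex.I * x) - (1 + Complex.I * x - x ^ 2 / 2)‖ ≤ 4 * x ^ 2 ∧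
    ‖Complex.exp (Complex.I * x) - (1 + Complex.I * x - x ^ 2 / 2)‖ ≤ 4 * |x| * x ^ 2 := by
  have hn : ‖Complex.I * (x : ℂ)‖ = |x| := by simp
  rcases le_or_gt |x| 1 with hx | hx
  · have h1 := Complex.exp_bound (x := Complex.I * x) (by rwa [hn]) (n := 3) (by norm_num)
    have h2 : ∑ j ∈ Finset.range 3, (Complex.I * (x : ℂ)) ^ j / (j.factorial : ℂ)
        = 1 + Complex.I * x - x ^ 2 / 2 := by
      simp only [Finset.sum_range_succ, Finset.sum_range_zero, Nat.factorial]
      push_cast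
      rw [mul_pow Complex.I (x : ℂ) 2, Complex.I_sq]
      ring
    rw [h2, hn] at h1
    have h3 : |x| ^ 3 * (((3 : ℕ).succ : ℝ) * (((3 : ℕ).factorial : ℝ) * ((3 : ℕ) : ℝ))⁻¹)
        ≤ 4 * |x| * x ^ 2 := by
      rw [← sq_abs x]
      norm_num [Nat.factorial]
      have := sq_abs x
      rw [← this]
      nlinarith [pow_nonneg (abs_nonneg x) 3]
    refine ⟨(h1.trans h3).trans ?_, h1.trans h3⟩
    nlinarith [sq_nonneg x, abs_nonneg x]
  · have h1 : ‖Complex.exp (Complex.I * x) - (1 + Complex.I * x - x ^ 2 / 2)‖ ≤ 4 * x ^ 2 := by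
      have h2 : ‖Complex.exp (Complex.I * x)‖ = 1 := by simp [Complex.norm_exp]
      have h3 : ‖(x : ℂ) ^ 2 / 2‖ = x ^ 2 / 2 := by
        rw [norm_div, norm_pow, Complex.norm_real, Real.norm_eq_abs, sq_abs]; norm_num
      have h4 := norm_sub_le (Complex.exp (Complex.I * x)) (1 + Complex.I * x - x ^ 2 / 2)
      have h5 := norm_sub_le (1 + Complex.I * (x : ℂ)) (x ^ 2 / 2)
      have h6 := norm_add_le (1 : ℂ) (Complex.I * x)
      rw [hn, norm_one] at h6
      rw [h2] at h4
      rw [h3] at h5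
      rw [← sq_abs x] at h5 ⊢
      nlinarith
    refine ⟨h1, h1.trans ?_⟩
    nlinarith [sq_nonneg x]

end Basic

end CondTensor

end

/-! ### Uniform estimates over the class of tame densities -/

noncomputable section

namespace CondTensor

open scoped ENNReal

/-- Pointwise `|f|^q ≤ |f| + |f|^p`; the outer power `1 / q ≤ 1` is dropped because the base is at
least `1`. The bound is independent of `q`, hence of `N`. -/
theorem eLpNorm_toReal_le {p L : ℝ} {f : ℝ → ℝ} (hf : Measurable f)
    (hf0 : ∀ v, 0 ≤ f v) (hfi : Integrable f) (hf1 : ∫ v, f v = 1)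
    (hfp : eLpNorm f (ENNReal.ofReal p) volume ≤ ENNReal.ofReal L) {q : ℝ} (hq : 1 ≤ q)
    (hqp : q ≤ p) :
    eLpNorm f (ENNReal.ofReal q) volume ≤ 1 + ENNReal.ofReal L ^ p := by
  have hq0 : 0 < q := by linarith
  have hp0 : 0 < p := by linarith
  have h1 : ∫⁻ v, ‖f v‖ₑ = 1 := by
    have : ∀ v, ‖f v‖ₑ = ENNReal.ofReal (f v) := fun v => Real.enorm_of_nonneg (hf0 v)
    simp_rw [this]
    rw [← ofReal_integral_eq_lintegral_ofReal hfi (.of_forall hf0), hf1]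
    simp
  have h2 : ∫⁻ v, ‖f v‖ₑ ^ p ≤ ENNReal.ofReal L ^ p := by
    rw [eLpNorm_eq_lintegral_rpow_enorm_toReal (by simpa using hp0) (by simp),
      ENNReal.toReal_ofReal hp0.le, one_div, ENNReal.rpow_inv_le_iff hp0] at hfp
    exact hfp
  have h3 : ∫⁻ v, ‖f v‖ₑ ^ q ≤ 1 + ENNReal.ofReal L ^ p := by
    calc ∫⁻ v, ‖f v‖ₑ ^ q ≤ ∫⁻ v, (‖f v‖ₑ + ‖f v‖ₑ ^ p) := by
          refine lintegral_mono fun v => ?_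
          rcases le_total ‖f v‖ₑ 1 with h | h
          · refine le_add_right ?_
            simpa using ENNReal.rpow_le_rpow_of_exponent_ge h hq
          · exact le_add_left (ENNReal.rpow_le_rpow_of_exponent_le h hqp)
      _ = (∫⁻ v, ‖f v‖ₑ) + ∫⁻ v, ‖f v‖ₑ ^ p := lintegral_add_left hf.enorm _
      _ ≤ _ := by rw [h1]; gcongr
  rw [eLpNorm_eq_lintegral_rpow_enorm_toReal (by simpa using hq0) (by simp),
      ENNReal.toReal_ofReal hq0.le]
  calc _ ≤ (1 + ENNReal.ofReal L ^ p) ^ (1 / q) := by gcongr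
    _ ≤ (1 + ENNReal.ofReal L ^ p) ^ (1 : ℝ) := by
        refine ENNReal.rpow_le_rpow_of_exponent_le le_self_add ?_
        rw [div_le_one hq0]; exact hq
    _ = _ := ENNReal.rpow_one _

/-- Large dimensions give Hölder exponents `N / (N - 2)` between `1` and `p`. -/
theorem exists_dim_exponent_le {p : ℝ} (hp : 1 < p) :
    ∃ m : ℕ, 3 ≤ m ∧ ∀ N : ℕ, m ≤ N → 1 ≤ (N : ℝ) / (N - 2) ∧ (N : ℝ) / (N - 2) ≤ p := by
  obtain ⟨n, hn⟩ := exists_nat_gt (2 * p / (p - 1))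
  refine ⟨max 3 n, le_max_left _ _, fun N hN => ?_⟩
  have h3 : (3 : ℝ) ≤ N := by exact_mod_cast (le_max_left 3 n).trans hN
  have hnN : (n : ℝ) ≤ N := by exact_mod_cast (le_max_right 3 n).trans hN
  rw [le_div_iff₀ (by linarith), div_le_iff₀ (by linarith)]
  rw [div_lt_iff₀ (by linarith)] at hn
  constructor
  · linarith
  · nlinarith

variable {p Emax Smin L : ℝ} {χ : ℝ → ℝ} {f : ℝ → ℝ}

namespace TameDensity

theorem integrable_sq (h : TameDensity p Emax Smin L χ f) : Integrable fun v => f v * v ^ 2 := by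
  refine Integrable.mono' (h.integrable.add h.integrable_pow_four)
    (h.integrable.aestronglyMeasurable.mul (by fun_prop)) (.of_forall fun v => ?_)
  have := h.nonneg v
  rw [Real.norm_of_nonneg (by positivity)]
  simp only [Pi.add_apply]
  nlinarith [sq_nonneg (v ^ 2 - 1), mul_nonneg this (sq_nonneg (v ^ 2 - 1)), mul_nonneg this (sq_nonneg v)]

theorem energy_nonneg (h : TameDensity p Emax Smin L χ f) : 0 ≤ energy f :=
  integral_nonneg fun v => mul_nonneg (h.nonneg v) (sq_nonneg v)

theorem integrable_variance (h : TameDensity p Emax Smin L χ f) :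
    Integrable fun v => (v ^ 2 - energy f) ^ 2 * f v := by
  have := ((h.integrable_pow_four.sub (h.integrable_sq.const_mul (2 * energy f))).add
    (h.integrable.const_mul (energy f ^ 2)))
  refine this.congr (.of_forall fun v => ?_)
  simp only [Pi.add_apply, Pi.sub_apply]
  ring

theorem energyDev_sq (h : TameDensity p Emax Smin L χ f) :
    energyDev f ^ 2 = ∫ v, (v ^ 2 - energy f) ^ 2 * f v :=
  Real.sq_sqrt (integral_nonneg fun v => mul_nonneg (sq_nonneg _) (h.nonneg v))

theorem energyDev_sq_le (h : TameDensity p Emax Smin L χ f) :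
    energyDev f ^ 2 ≤ ∫ v, f v * v ^ 4 := by
  have h1 : ∫ v, (v ^ 2 - energy f) ^ 2 * f v = (∫ v, f v * v ^ 4) - energy f ^ 2 := by
    have h2 : ∀ v, (v ^ 2 - energy f) ^ 2 * f v
        = f v * v ^ 4 - (2 * energy f * (f v * v ^ 2) - energy f ^ 2 * f v) := fun v => by ring
    simp_rw [h2]
    have h3 : Integrable fun v => 2 * energy f * (f v * v ^ 2) - energy f ^ 2 * f v :=
      (h.integrable_sq.const_mul _).sub (h.integrable.const_mul _)
    rw [integral_sub h.integrable_pow_four h3,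
      integral_sub (h.integrable_sq.const_mul _) (h.integrable.const_mul _), integral_const_mul,
      integral_const_mul, h.integral_eq_one, ← energy]
    ring
  rw [h.energyDev_sq, h1]
  linarith [sq_nonneg (energy f)]

theorem integral_pow_four_le (h : TameDensity p Emax Smin L χ f) {r : ℝ} (hr : 0 < r) :
    ∫ v, f v * v ^ 4 ≤ (1 / r) ^ 4 + χ r := by
  have hs : MeasurableSet {v : ℝ | 1 / r ≤ |v|} := measurableSet_le measurable_const (by fun_prop)
  rw [← integral_add_compl hs h.integrable_pow_four, add_comm]
  refine add_le_add ?_ (h.tail_le r hr)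
  calc ∫ v in {v : ℝ | 1 / r ≤ |v|}ᶜ, f v * v ^ 4
      ≤ ∫ v in {v : ℝ | 1 / r ≤ |v|}ᶜ, f v * (1 / r) ^ 4 := by
        refine setIntegral_mono_on h.integrable_pow_four.integrableOn
          (h.integrable.mul_const _).integrableOn hs.compl fun v hv => ?_
        have hv : |v| < 1 / r := not_le.1 hv
        have := h.nonneg v
        rw [show v ^ 4 = |v| ^ 4 from (Even.pow_abs (by decide) v).symm]
        gcongr
    _ ≤ ∫ v, f v * (1 / r) ^ 4 :=
        setIntegral_le_integral (h.integrable.mul_const _)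
          (.of_forall fun v => mul_nonneg (h.nonneg v) (by positivity))
    _ = (1 / r) ^ 4 := by rw [integral_mul_const, h.integral_eq_one, one_mul]

end TameDensity

theorem exists_energyDev_sq_le (hχ : Tendsto χ (𝓝[>] 0) (𝓝 0)) :
    ∃ K : ℝ, 0 < K ∧ ∀ f, TameDensity p Emax Smin L χ f → energyDev f ^ 2 ≤ K := by
  have h1 : ∀ᶠ r in 𝓝[>] (0 : ℝ), χ r < 1 := hχ.eventually_lt_const one_pos
  obtain ⟨r, hr1, hr⟩ := (h1.and self_mem_nhdsWithin).exists
  have hr : 0 < r := hr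
  refine ⟨(1 / r) ^ 4 + 1, by positivity, fun f h => ?_⟩
  linarith [h.energyDev_sq_le, h.integral_pow_four_le hr]

/-- Plancherel for the energy of `m` particles: `m` is chosen so that `m / (m - 2) ≤ p`, which makes
that density bounded although the law of a single `v²` need not have a bounded one. -/
theorem exists_lintegral_norm_charSq_pow_le (hp : 1 < p) :
    ∃ (m : ℕ) (C : ℝ), 3 ≤ m ∧
      (∀ N : ℕ, m ≤ N → 1 ≤ (N : ℝ) / (N - 2) ∧ (N : ℝ) / (N - 2) ≤ p) ∧
      ∀ f, TameDensity p Emax Smin L χ f →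
        ∫⁻ t, ENNReal.ofReal (‖charSq f t‖ ^ (2 * m)) ≤ ENNReal.ofReal C := by
  obtain ⟨m, hm, hmp⟩ := exists_dim_exponent_le hp
  have hfin : (1 + ENNReal.ofReal L ^ p) ≠ ∞ :=
    ENNReal.add_ne_top.2 ⟨by simp, ENNReal.rpow_ne_top_of_nonneg (by linarith) (by simp)⟩
  refine ⟨m, 2 * Real.pi * (3 * Real.pi / 2 * (1 + ENNReal.ofReal L ^ p).toReal ^ m), hm, hmp,
    fun f h => ?_⟩
  have hle := eLpNorm_toReal_le h.measurable h.nonneg h.integrable h.integral_eq_one h.eLpNorm_le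
    (hmp m le_rfl).1 (hmp m le_rfl).2
  have hlt := hle.trans_lt hfin.lt_top
  have h1 := lintegral_enorm_sq_le (D := energyDensity m f) (φ := fun t => charSq f t ^ m)
    (M := 3 * Real.pi / 2 * (1 + ENNReal.ofReal L ^ p).toReal ^ m)
    (integrable_energyDensity hm h.measurable h.nonneg h.integrable h.integral_eq_one rfl hlt)
    (energyDensity_nonneg h.nonneg)
    (integral_energyDensity hm h.measurable h.nonneg h.integrable h.integral_eq_one rfl hlt)
    (fun s => (energyDensity_le hm h.measurable rfl hlt s).trans (by
      gcongr))
    ((continuous_charSq h.integrable).pow m)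
    (integral_exp_mul_energyDensity hm h.measurable h.nonneg rfl hlt)
  refine le_trans (le_of_eq ?_) h1
  refine lintegral_congr fun t => ?_
  rw [norm_pow, ← pow_mul, mul_comm]

/-- Second-order expansion at `0` of the centred characteristic function, uniformly over tame
densities. -/
theorem exists_norm_charSq_sub_taylor_le (hχ : Tendsto χ (𝓝[>] 0) (𝓝 0)) {η : ℝ} (hη : 0 < η) :
    ∃ δ : ℝ, 0 < δ ∧ ∀ f, TameDensity p Emax Smin L χ f → ∀ t : ℝ, |t| ≤ δ →
      ‖Complex.exp (-(Complex.I * (t * energy f))) * charSq f t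
        - (1 - energyDev f ^ 2 * t ^ 2 / 2 : ℝ)‖ ≤ η * t ^ 2 := by
  obtain ⟨K, hK, hKf⟩ := exists_energyDev_sq_le (p := p) (Emax := Emax) (Smin := Smin) (L := L) hχ
  have h1 : ∀ᶠ r in 𝓝[>] (0 : ℝ), χ r < η / 8 := hχ.eventually_lt_const (by positivity)
  have h2 : ∀ᶠ r in 𝓝[>] (0 : ℝ), r < 1 / (|Emax| + 1) :=
    (tendsto_id.mono_left nhdsWithin_le_nhds).eventually_lt_const (by positivity)
  -- The cutoff `1 / r` is large enough that the fourth-moment tail is below `η / 8` and that `E ≤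
  -- v²` beyond it, whence `(v² - E)² ≤ v⁴` there.
  obtain ⟨r, ⟨hrχ, hrE⟩, hr⟩ := ((h1.and h2).and self_mem_nhdsWithin).exists
  have hr : 0 < r := hr
  have hrE' : |Emax| + 1 < 1 / r := by
    rw [lt_div_iff₀ hr]; rw [lt_div_iff₀ (by positivity)] at hrE; linarith
  have hrE2 : Emax ≤ (1 / r) ^ 2 := by
    have : 1 ≤ 1 / r := by linarith [abs_nonneg Emax]
    nlinarith [le_abs_self Emax]
  set B : ℝ := (1 / r) ^ 2 + |Emax| with hB
  have hB0 : 0 < B := by positivity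
  -- `B` bounds `|v² - E|` below the cutoff and `K` bounds `Σ²`; this choice makes the bulk
  -- contribution `4 |t| B K t²` at most `η t² / 2`, and the tail contributes the other half.
  refine ⟨η / (8 * B * K), by positivity, fun f h t ht => ?_⟩
  set E := energy f with hE
  have hE0 : 0 ≤ E := h.energy_nonneg
  have hEE : E ≤ Emax := h.energy_le
  let R : ℝ → ℂ := fun x => Complex.exp (Complex.I * x) - (1 + Complex.I * x - x ^ 2 / 2)
  have hmean : ∫ v, (v ^ 2 - E) * f v = 0 := by
    have : ∀ v, (v ^ 2 - E) * f v = f v * v ^ 2 - E * f v := fun v => by ring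
    simp_rw [this]
    rw [integral_sub h.integrable_sq (h.integrable.const_mul _), integral_const_mul,
      h.integral_eq_one, ← energy]
    ring
  have hmeani : Integrable fun v => (v ^ 2 - E) * f v := by
    refine (h.integrable_sq.sub (h.integrable.const_mul E)).congr (.of_forall fun v => ?_)
    simp only [Pi.sub_apply]; ring
  have hid : Complex.exp (-(Complex.I * (t * E))) * charSq f t
        - (1 - energyDev f ^ 2 * t ^ 2 / 2 : ℝ) = ∫ v, R (t * (v ^ 2 - E)) * f v := by
    have e1 : ∀ v : ℝ, R (t * (v ^ 2 - E)) * f v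
        = Complex.exp (-(Complex.I * (t * E))) * (Complex.exp (Complex.I * (t * v ^ 2)) * f v)
          - ((f v : ℂ) + ((Complex.I * t) * ((v ^ 2 - E) * f v : ℝ)
          - (t ^ 2 / 2 : ℂ) * ((v ^ 2 - E) ^ 2 * f v : ℝ))) := by
      intro v
      have : Complex.exp (Complex.I * (t * (v ^ 2 - E) : ℝ)) = Complex.exp (-(Complex.I * (t * E)))
          * Complex.exp (Complex.I * (t * v ^ 2)) := by
        rw [← Complex.exp_add]; congr 1; push_cast; ring
      simp only [R, this]
      push_cast
      ring
    simp_rw [e1]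
    have i1 := (integrable_charSq_integrand h.integrable t).const_mul
      (Complex.exp (-(Complex.I * (t * E))))
    have i2 : Integrable fun v => (Complex.I * t) * (((v ^ 2 - E) * f v : ℝ) : ℂ) :=
      hmeani.ofReal.const_mul _
    have i3 : Integrable fun v => (t ^ 2 / 2 : ℂ) * (((v ^ 2 - E) ^ 2 * f v : ℝ) : ℂ) :=
      h.integrable_variance.ofReal.const_mul _
    have i4 : Integrable fun v => (Complex.I * t) * (((v ^ 2 - E) * f v : ℝ) : ℂ)
        - (t ^ 2 / 2 : ℂ) * (((v ^ 2 - E) ^ 2 * f v : ℝ) : ℂ) := i2.sub i3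
    have i5 : Integrable fun v => (f v : ℂ) + ((Complex.I * t) * (((v ^ 2 - E) * f v : ℝ) : ℂ)
        - (t ^ 2 / 2 : ℂ) * (((v ^ 2 - E) ^ 2 * f v : ℝ) : ℂ)) := h.integrable.ofReal.add i4
    have i0 : Integrable fun v => (f v : ℂ) := h.integrable.ofReal
    rw [integral_sub i1 i5, integral_add i0 i4, integral_sub i2 i3, integral_const_mul,
      integral_const_mul, integral_const_mul, integral_complex_ofReal, integral_complex_ofReal,
      integral_complex_ofReal, hmean, h.integral_eq_one, ← h.energyDev_sq, ← charSq]
    push_cast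
    ring
  have hs : MeasurableSet {v : ℝ | 1 / r ≤ |v|} := measurableSet_le measurable_const (by fun_prop)
  have hbound : ∀ v : ℝ, ‖R (t * (v ^ 2 - E)) * f v‖ ≤
      4 * (|t| * B) * t ^ 2 * ((v ^ 2 - E) ^ 2 * f v)
        + 4 * t ^ 2 * {v : ℝ | 1 / r ≤ |v|}.indicator (fun v => f v * v ^ 4) v := by
    intro v
    have hf0 := h.nonneg v
    rw [norm_mul, Complex.norm_real, Real.norm_of_nonneg hf0]
    obtain ⟨hR1, hR2⟩ := norm_exp_I_mul_sub_taylor_le (t * (v ^ 2 - E))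
    by_cases hv : 1 / r ≤ |v|
    · rw [Set.indicator_of_mem (show v ∈ {v : ℝ | 1 / r ≤ |v|} from hv)]
      have hv2 : (1 / r) ^ 2 ≤ v ^ 2 := by
        rw [← sq_abs v]; gcongr
      have h3 : (v ^ 2 - E) ^ 2 ≤ v ^ 4 := by nlinarith
      calc ‖R (t * (v ^ 2 - E))‖ * f v ≤ 4 * (t * (v ^ 2 - E)) ^ 2 * f v := by gcongr
        _ = 4 * t ^ 2 * (f v * (v ^ 2 - E) ^ 2) := by ring
        _ ≤ 4 * t ^ 2 * (f v * v ^ 4) := by gcongr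
        _ ≤ _ := le_add_of_nonneg_left (by positivity)
    · rw [Set.indicator_of_notMem (show v ∉ {v : ℝ | 1 / r ≤ |v|} from hv), mul_zero, add_zero]
      have hv2 : v ^ 2 ≤ (1 / r) ^ 2 := by
        rw [← sq_abs v]; gcongr; exact (not_le.1 hv).le
      have h3 : |v ^ 2 - E| ≤ B := by
        rw [abs_le]
        constructor <;> nlinarith [sq_nonneg v, le_abs_self Emax, sq_nonneg (1 / r)]
      calc ‖R (t * (v ^ 2 - E))‖ * f v
          ≤ 4 * |t * (v ^ 2 - E)| * (t * (v ^ 2 - E)) ^ 2 * f v := by gcongr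
        _ = 4 * (|t| * |v ^ 2 - E|) * t ^ 2 * ((v ^ 2 - E) ^ 2 * f v) := by
            rw [abs_mul]; ring
        _ ≤ _ := by gcongr
  have hint1 := h.integrable_variance.const_mul (4 * (|t| * B) * t ^ 2)
  have hint2 := (h.integrable_pow_four.indicator hs).const_mul (4 * t ^ 2)
  rw [hid]
  refine (norm_integral_le_of_norm_le (hint1.add hint2) (.of_forall hbound)).trans ?_
  simp only [Pi.add_apply]
  rw [integral_add hint1 hint2, integral_const_mul, integral_const_mul, integral_indicator hs,
    ← h.energyDev_sq]
  have h5 := h.tail_le r hr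
  have h6 := hKf f h
  have h7 : |t| * (8 * B * K) ≤ η := by rwa [le_div_iff₀ (by positivity)] at ht
  calc 4 * (|t| * B) * t ^ 2 * energyDev f ^ 2
        + 4 * t ^ 2 * ∫ v in {v : ℝ | 1 / r ≤ |v|}, f v * v ^ 4
      ≤ 4 * (|t| * B) * t ^ 2 * K + 4 * t ^ 2 * (η / 8) := by
        gcongr
        linarith
    _ = t ^ 2 * (|t| * (8 * B * K)) / 2 + t ^ 2 * η / 2 := by ring
    _ ≤ t ^ 2 * η / 2 + t ^ 2 * η / 2 := by gcongr
    _ = η * t ^ 2 := by ring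

end CondTensor

end

/-! ### Uniform local central limit theorem -/

noncomputable section

namespace CondTensor

open scoped ENNReal

theorem norm_pow_sub_pow_le_mul {a b : ℂ} {ρ : ℝ} (ha : ‖a‖ ≤ ρ) (hb : ‖b‖ ≤ ρ) (n : ℕ) :
    ‖a ^ n - b ^ n‖ ≤ n * ‖a - b‖ * ρ ^ (n - 1) := by
  have hρ : 0 ≤ ρ := (norm_nonneg a).trans ha
  have hsucc : ∀ k : ℕ, ‖a ^ (k + 1) - b ^ (k + 1)‖ ≤ (k + 1) * ‖a - b‖ * ρ ^ k := by
    intro k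
    induction k with
    | zero => simp
    | succ k ih =>
      have h1 : a ^ (k + 1 + 1) - b ^ (k + 1 + 1)
          = a * (a ^ (k + 1) - b ^ (k + 1)) + (a - b) * b ^ (k + 1) := by ring
      rw [h1]
      refine (norm_add_le _ _).trans ?_
      rw [norm_mul, norm_mul, norm_pow]
      calc ‖a‖ * ‖a ^ (k + 1) - b ^ (k + 1)‖ + ‖a - b‖ * ‖b‖ ^ (k + 1)
          ≤ ρ * ((k + 1) * ‖a - b‖ * ρ ^ k) + ‖a - b‖ * ρ ^ (k + 1) := by gcongr
        _ = _ := by push_cast; ring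
  cases n with
  | zero => simp
  | succ k => simpa using hsucc k

/-- A number close to `1 - σ t² / 2` has `N`-th power close to `exp (-N σ t² / 2)`. -/
theorem norm_pow_sub_exp_le {a : ℂ} {σ t η β : ℝ} {N : ℕ} (hN : 2 ≤ N) (hη : 0 ≤ η) (hβ : 0 < β)
    (hβσ : 8 * β ≤ σ) (hησ : η ≤ 2 * β)
    (ha : ‖a - (1 - σ * t ^ 2 / 2 : ℝ)‖ ≤ η * t ^ 2) (h1 : σ * t ^ 2 / 2 ≤ 1)
    (h2 : (σ * t ^ 2 / 2) ^ 2 ≤ η * t ^ 2) :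
    ‖a ^ N - (Real.exp (-(N * (σ * t ^ 2 / 2))) : ℝ)‖
      ≤ 4 * η / β * Real.exp (-(N * β / 2) * t ^ 2) := by
  set x := σ * t ^ 2 / 2 with hx
  have hσ : 0 < σ := by linarith
  have hx0 : 0 ≤ x := by positivity
  have hN' : (2 : ℝ) ≤ N := by exact_mod_cast hN
  have hexp : |Real.exp (-x) - (1 - x)| ≤ x ^ 2 := by
    have := Real.abs_exp_sub_one_sub_id_le (x := -x) (by rwa [abs_neg, abs_of_nonneg hx0])
    rwa [neg_sq, show Real.exp (-x) - 1 - -x = Real.exp (-x) - (1 - x) by ring] at this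
  have hab : ‖a - (Real.exp (-x) : ℝ)‖ ≤ 2 * η * t ^ 2 := by
    have e1 : a - (Real.exp (-x) : ℝ) = (a - (1 - x : ℝ)) - ((Real.exp (-x) - (1 - x) : ℝ) : ℂ) := by
      push_cast; ring
    rw [e1]
    refine (norm_sub_le _ _).trans ?_
    rw [Complex.norm_real, Real.norm_eq_abs]
    linarith
  -- The error `η t²` is at most `x / 2`, so `|a| ≤ 1 - x / 2 ≤ exp (-x / 2)`: both bases share this
  -- bound.
  have haρ : ‖a‖ ≤ Real.exp (-(x / 2)) := by
    have e1 : ‖a‖ ≤ ‖a - (1 - x : ℝ)‖ + ‖((1 - x : ℝ) : ℂ)‖ := by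
      simpa using norm_add_le (a - (1 - x : ℝ)) ((1 - x : ℝ) : ℂ)
    rw [Complex.norm_real, Real.norm_of_nonneg (by linarith)] at e1
    have e2 : η * t ^ 2 ≤ x / 2 := by
      rw [hx]; nlinarith [sq_nonneg t]
    linarith [Real.add_one_le_exp (-(x / 2))]
  have hbρ : ‖((Real.exp (-x) : ℝ) : ℂ)‖ ≤ Real.exp (-(x / 2)) := by
    rw [Complex.norm_real, Real.norm_of_nonneg (Real.exp_pos _).le]
    exact Real.exp_le_exp.2 (by linarith)
  have hmain := norm_pow_sub_pow_le_mul haρ hbρ N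
  have hpow : ((Real.exp (-(N * x)) : ℝ) : ℂ) = ((Real.exp (-x) : ℝ) : ℂ) ^ N := by
    rw [← Complex.ofReal_pow, ← Real.exp_nat_mul]; congr 2; ring
  rw [hpow]
  refine hmain.trans ?_
  set y := N * β * t ^ 2 with hy
  have hy0 : 0 ≤ y := by positivity
  -- Since `x ≥ 4 β t²` and `2 (N - 1) ≥ N`, the missing power costs only a factor `2` in the
  -- exponent.
  have hρ : Real.exp (-(x / 2)) ^ (N - 1) ≤ Real.exp (-y) := by
    rw [← Real.exp_nat_mul]
    refine Real.exp_le_exp.2 ?_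
    rw [Nat.cast_sub (by omega), Nat.cast_one]
    have e1 : 4 * β * t ^ 2 ≤ x := by rw [hx]; nlinarith [sq_nonneg t]
    have e2 : y ≤ (N - 1) * (2 * β * t ^ 2) := by
      rw [hy]
      nlinarith [mul_nonneg hβ.le (sq_nonneg t)]
    nlinarith
  have hyexp : y * Real.exp (-y) ≤ 2 * Real.exp (-(N * β / 2) * t ^ 2) := by
    have e1 : Real.exp (-y) = Real.exp (-(y / 2)) * Real.exp (-(y / 2)) := by
      rw [← Real.exp_add]; congr 1; ring
    have e2 : -(N * β / 2) * t ^ 2 = -(y / 2) := by rw [hy]; ring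
    have e3 : y / 2 * Real.exp (-(y / 2)) ≤ 1 := by
      rw [Real.exp_neg, ← div_eq_mul_inv, div_le_one (Real.exp_pos _)]
      linarith [Real.add_one_le_exp (y / 2)]
    rw [e1, e2]
    nlinarith [Real.exp_pos (-(y / 2))]
  calc N * ‖a - (Real.exp (-x) : ℝ)‖ * Real.exp (-(x / 2)) ^ (N - 1)
      ≤ N * (2 * η * t ^ 2) * Real.exp (-y) := by gcongr
    _ = 2 * η / β * (y * Real.exp (-y)) := by rw [hy]; field_simp
    _ ≤ 2 * η / β * (2 * Real.exp (-(N * β / 2) * t ^ 2)) := by gcongr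
    _ = _ := by ring

variable {p Emax Smin L : ℝ} {χ : ℝ → ℝ}

theorem integrable_norm_charSq_pow {f : ℝ → ℝ} (hfi : Integrable f) {k : ℕ} {C : ℝ}
    (hC : ∫⁻ t, ENNReal.ofReal (‖charSq f t‖ ^ k) ≤ ENNReal.ofReal C) :
    Integrable (fun t => ‖charSq f t‖ ^ k) ∧ ∫ t, ‖charSq f t‖ ^ k ≤ |C| := by
  have hc : Continuous fun t => ‖charSq f t‖ ^ k := (continuous_charSq hfi).norm.pow k
  have h0 : ∀ t, 0 ≤ ‖charSq f t‖ ^ k := fun t => by positivity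
  refine ⟨⟨hc.aestronglyMeasurable, ?_⟩, ?_⟩
  · rw [hasFiniteIntegral_iff_ofReal (.of_forall h0)]
    exact hC.trans_lt ENNReal.ofReal_lt_top
  · rw [integral_eq_lintegral_of_nonneg_ae (.of_forall h0) hc.aestronglyMeasurable]
    refine ENNReal.toReal_le_of_le_ofReal (abs_nonneg C) (hC.trans ?_)
    exact ENNReal.ofReal_le_ofReal (le_abs_self C)

set_option maxHeartbeats 1000000 in
/-- Uniform `L¹` Gaussian approximation of powers of the centred characteristic functions. -/
theorem exists_integral_norm_charSq_pow_sub_le (hp : 1 < p) (hSmin : 0 < Smin)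
    (hχ : Tendsto χ (𝓝[>] 0) (𝓝 0)) {η : ℝ} (hη : 0 < η) :
    ∃ M : ℕ, ∀ N ≥ M, ∀ f, TameDensity p Emax Smin L χ f →
      Integrable (fun t => charSq f t ^ N) ∧
      √N * ∫ t : ℝ, ‖(Complex.exp (-(Complex.I * (t * energy f))) * charSq f t) ^ N
        - (Real.exp (-(N * (energyDev f ^ 2 * t ^ 2 / 2))) : ℝ)‖ ≤ η := by
  obtain ⟨m, C, hm, -, hC⟩ := exists_lintegral_norm_charSq_pow_le (Emax := Emax) (Smin := Smin)
    (L := L) (χ := χ) hp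
  obtain ⟨K, hK, hKf⟩ := exists_energyDev_sq_le (p := p) (Emax := Emax) (Smin := Smin) (L := L) hχ
  set β : ℝ := Smin ^ 2 / 8 with hβ
  have hβ0 : 0 < β := by positivity
  -- The second entry makes the Gaussian part, after multiplication by `√N`, equal to at most `η /
  -- 2`.
  set η' : ℝ := min (2 * β) (η * β / (8 * √(2 * Real.pi / β))) with hη'
  have hη'0 : 0 < η' := by positivity
  obtain ⟨δ₁, hδ₁, hδ₁f⟩ := exists_norm_charSq_sub_taylor_le (p := p) (Emax := Emax)
    (Smin := Smin) (L := L) hχ hη'0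
  -- Besides the range of the Taylor bound, the entries force `σ t² / 2 ≤ 1` and `(σ t² / 2)² ≤ η'
  -- t²`, as `norm_pow_sub_exp_le` requires.
  set δ : ℝ := min δ₁ (min 1 (min (1 / (K + 1)) (η' / (K + 1) ^ 2))) with hδ
  have hδ0 : 0 < δ := by positivity
  have hδ1 : δ ≤ δ₁ := min_le_left _ _
  have hδ2 : δ ≤ 1 := (min_le_right _ _).trans (min_le_left _ _)
  have hδ3 : δ ≤ 1 / (K + 1) :=
    (min_le_right _ _).trans ((min_le_right _ _).trans (min_le_left _ _))
  have hδ4 : δ ≤ η' / (K + 1) ^ 2 :=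
    (min_le_right _ _).trans ((min_le_right _ _).trans (min_le_right _ _))
  obtain ⟨κ, hκ0, hκ1, hκf⟩ := exists_norm_charSq_le m C Emax δ hδ0
  set ρ₁ : ℝ := 1 - κ with hρ₁
  set ρ₂ : ℝ := Real.exp (-(4 * β * δ ^ 2 / 2)) with hρ₂
  have hρ₁0 : 0 < ρ₁ := by linarith
  have hρ₂0 : 0 < ρ₂ := Real.exp_pos _
  have hρ₂1 : ρ₂ < 1 := by
    rw [hρ₂, Real.exp_lt_one_iff]
    have : 0 < 4 * β * δ ^ 2 / 2 := by positivity
    linarith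
  set C₁ : ℝ := |C| / ρ₁ ^ (2 * m) with hC₁
  set C₂ : ℝ := ∫ t : ℝ, Real.exp (-(2 * β) * t ^ 2) with hC₂
  have hC₂0 : 0 ≤ C₂ := integral_nonneg fun t => (Real.exp_pos _).le
  have hlim : Tendsto (fun N : ℕ => (N * ρ₁ ^ N) * C₁ + (N * ρ₂ ^ N) * C₂) atTop (𝓝 0) := by
    have t1 := (tendsto_self_mul_const_pow_of_lt_one hρ₁0.le (by linarith)).mul_const C₁
    have t2 := (tendsto_self_mul_const_pow_of_lt_one hρ₂0.le hρ₂1).mul_const C₂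
    simpa using t1.add t2
  obtain ⟨M, hM⟩ := eventually_atTop.1 (hlim.eventually_lt_const (half_pos hη))
  refine ⟨max M (2 * m), fun N hN f h => ?_⟩
  have hNM : M ≤ N := (le_max_left _ _).trans hN
  have hNm : 2 * m ≤ N := (le_max_right _ _).trans hN
  have hN2 : 2 ≤ N := by omega
  have hN1 : (1 : ℝ) ≤ N := by exact_mod_cast (by omega : 1 ≤ N)
  have hN0 : (0 : ℝ) < N := by linarith
  obtain ⟨hi, hiC⟩ := integrable_norm_charSq_pow h.integrable (hC f h)
  have hφ1 := norm_charSq_le_one h.nonneg h.integral_eq_one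
  have hcont := continuous_charSq h.integrable
  have hφN : ∀ t, ‖charSq f t‖ ^ N ≤ ‖charSq f t‖ ^ (2 * m) := fun t =>
    pow_le_pow_of_le_one (norm_nonneg _) (hφ1 t) hNm
  refine ⟨Integrable.mono' hi (hcont.pow N).aestronglyMeasurable
    (.of_forall fun t => by rw [norm_pow]; exact hφN t), ?_⟩
  set σ := energyDev f ^ 2 with hσ
  have hσβ : 8 * β ≤ σ := by
    have := h.le_energyDev
    rw [hβ, hσ]
    have : Smin ^ 2 ≤ energyDev f ^ 2 := by gcongr
    linarith
  have hσK : σ ≤ K := hKf f h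
  have hσ0 : 0 < σ := by linarith
  have hnormφ : ∀ t : ℝ, ‖Complex.exp (-(Complex.I * (t * energy f))) * charSq f t‖
      = ‖charSq f t‖ := by
    intro t
    rw [norm_mul, show ‖Complex.exp (-(Complex.I * (t * energy f)))‖ = 1 by
      simp [Complex.norm_exp], one_mul]
  -- The first term dominates for `|t| ≤ δ`, the other two for `|t| ≥ δ`. Their sum bounds the
  -- integrand everywhere, so the integral need not be split. In the outer region `2m` powers of the
  -- characteristic function are kept for integrability and the rest decay like `ρ₁^(N - 2m)`.
  have hbound : ∀ t : ℝ, ‖(Complex.exp (-(Complex.I * (t * energy f))) * charSq f t) ^ N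
        - (Real.exp (-(N * (σ * t ^ 2 / 2))) : ℝ)‖
      ≤ 4 * η' / β * Real.exp (-(N * β / 2) * t ^ 2) + ρ₁ ^ (N - 2 * m) * ‖charSq f t‖ ^ (2 * m)
        + ρ₂ ^ N * Real.exp (-(2 * β) * t ^ 2) := by
    intro t
    rcases le_total |t| δ with ht | ht
    · have ht2 : t ^ 2 ≤ δ * 1 := by
        rw [← sq_abs, sq]
        exact mul_le_mul ht (ht.trans hδ2) (abs_nonneg _) hδ0.le
      have hKδ : (K + 1) * δ ≤ 1 := by
        rw [le_div_iff₀ (by positivity)] at hδ3; linarith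
      have hKδ2 : (K + 1) ^ 2 * δ ≤ η' := by
        rw [le_div_iff₀ (by positivity)] at hδ4; linarith
      have e1 : σ * t ^ 2 / 2 ≤ 1 := by
        have : σ * t ^ 2 ≤ (K + 1) * (δ * 1) := by gcongr; linarith
        linarith
      have e2 : (σ * t ^ 2 / 2) ^ 2 ≤ η' * t ^ 2 := by
        have : σ ^ 2 * t ^ 2 ≤ η' := by
          calc σ ^ 2 * t ^ 2 ≤ (K + 1) ^ 2 * (δ * 1) := by gcongr; linarith
            _ ≤ η' := by linarith
        have h3 : (σ * t ^ 2 / 2) ^ 2 = σ ^ 2 * t ^ 2 * t ^ 2 / 4 := by ring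
        have h4 : σ ^ 2 * t ^ 2 * t ^ 2 ≤ η' * t ^ 2 := by gcongr
        have h5 : 0 ≤ η' * t ^ 2 := by positivity
        linarith
      have := norm_pow_sub_exp_le hN2 hη'0.le hβ0 hσβ (min_le_left _ _)
        (hδ₁f f h t (ht.trans hδ1)) e1 e2
      refine this.trans ?_
      have : 0 ≤ ρ₁ ^ (N - 2 * m) * ‖charSq f t‖ ^ (2 * m) := by positivity
      have : 0 ≤ ρ₂ ^ N * Real.exp (-(2 * β) * t ^ 2) := by positivity
      linarith
    · have e1 := hκf f h.nonneg h.integrable h.integral_eq_one h.integrable_sq h.energy_le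
        (hC f h) t ht
      have e2 : ‖charSq f t‖ ^ N ≤ ρ₁ ^ (N - 2 * m) * ‖charSq f t‖ ^ (2 * m) := by
        rw [← Nat.sub_add_cancel hNm, pow_add, Nat.add_sub_cancel]
        gcongr
      have e3 : Real.exp (-(N * (σ * t ^ 2 / 2))) ≤ ρ₂ ^ N * Real.exp (-(2 * β) * t ^ 2) := by
        rw [hρ₂, ← Real.exp_nat_mul, ← Real.exp_add]
        refine Real.exp_le_exp.2 ?_
        have ht2 : δ ^ 2 ≤ t ^ 2 := by rw [← sq_abs t]; gcongr
        have h1 : 4 * β * t ^ 2 ≤ σ * t ^ 2 / 2 := by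
          have : 8 * β * t ^ 2 ≤ σ * t ^ 2 := by gcongr
          linarith
        have h2 : 2 * β * δ ^ 2 ≤ 2 * β * t ^ 2 := by gcongr
        have h3 : N * (4 * β * t ^ 2) ≤ N * (σ * t ^ 2 / 2) := by gcongr
        have h4 : N * (2 * β * δ ^ 2) ≤ N * (2 * β * t ^ 2) := by gcongr
        have h5 : 1 * (2 * β * t ^ 2) ≤ N * (2 * β * t ^ 2) := by gcongr
        linarith
      refine (norm_sub_le _ _).trans ?_
      rw [norm_pow, hnormφ, Complex.norm_real, Real.norm_of_nonneg (Real.exp_pos _).le]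
      have : 0 ≤ 4 * η' / β * Real.exp (-(N * β / 2) * t ^ 2) := by positivity
      linarith
  have hg1 : Integrable fun t : ℝ => 4 * η' / β * Real.exp (-(N * β / 2) * t ^ 2) :=
    (integrable_exp_neg_mul_sq (by positivity)).const_mul _
  have hg2 : Integrable fun t : ℝ => ρ₁ ^ (N - 2 * m) * ‖charSq f t‖ ^ (2 * m) := hi.const_mul _
  have hg3 : Integrable fun t : ℝ => ρ₂ ^ N * Real.exp (-(2 * β) * t ^ 2) :=
    (integrable_exp_neg_mul_sq (by positivity)).const_mul _
  have hg12 : Integrable fun t : ℝ => 4 * η' / β * Real.exp (-(N * β / 2) * t ^ 2)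
      + ρ₁ ^ (N - 2 * m) * ‖charSq f t‖ ^ (2 * m) := hg1.add hg2
  have hle : ∫ t : ℝ, ‖(Complex.exp (-(Complex.I * (t * energy f))) * charSq f t) ^ N
        - (Real.exp (-(N * (σ * t ^ 2 / 2))) : ℝ)‖
      ≤ 4 * η' / β * √(Real.pi / (N * β / 2)) + ρ₁ ^ (N - 2 * m) * |C| + ρ₂ ^ N * C₂ := by
    refine (integral_mono_of_nonneg (.of_forall fun t => norm_nonneg _) (hg12.add hg3)
      (.of_forall hbound)).trans ?_
    simp only [Pi.add_apply]
    rw [integral_add hg12 hg3, integral_add hg1 hg2, integral_const_mul, integral_const_mul,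
      integral_const_mul, integral_gaussian]
    gcongr
  have hsq : √N * √(Real.pi / (N * β / 2)) = √(2 * Real.pi / β) := by
    rw [← Real.sqrt_mul (by positivity)]
    congr 1
    field_simp
  have hη'2 : 4 * η' / β * √(2 * Real.pi / β) ≤ η / 2 := by
    have e1 : η' ≤ η * β / (8 * √(2 * Real.pi / β)) := min_le_right _ _
    have hpos : 0 < √(2 * Real.pi / β) := by positivity
    calc 4 * η' / β * √(2 * Real.pi / β)
        ≤ 4 * (η * β / (8 * √(2 * Real.pi / β))) / β * √(2 * Real.pi / β) := by gcongr
      _ = η / 2 := by field_simp; norm_num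
  have hsqrtN : √(N : ℝ) ≤ N := by
    exact Real.sqrt_le_iff.2 ⟨hN0.le, le_self_pow₀ hN1 two_ne_zero⟩
  have hpw : ρ₁ ^ (N - 2 * m) * |C| = ρ₁ ^ N * C₁ := by
    rw [hC₁, ← Nat.sub_add_cancel hNm, pow_add, Nat.add_sub_cancel]
    field_simp
  have hMN := hM N hNM
  have hC₁0 : 0 ≤ C₁ := by positivity
  calc _ ≤ √N * (4 * η' / β * √(Real.pi / (N * β / 2)) + ρ₁ ^ (N - 2 * m) * |C| + ρ₂ ^ N * C₂) := by
        gcongr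
    _ = 4 * η' / β * (√N * √(Real.pi / (N * β / 2))) + √N * (ρ₁ ^ N * C₁) + √N * (ρ₂ ^ N * C₂) := by
        rw [hpw]; ring
    _ ≤ η / 2 + N * (ρ₁ ^ N * C₁) + N * (ρ₂ ^ N * C₂) := by
        rw [hsq]
        gcongr
    _ ≤ η := by linarith

/-- Uniform local central limit theorem for the energy. -/
theorem exists_energyDensity_sub_gaussian_le (hp : 1 < p) (hSmin : 0 < Smin)
    (hχ : Tendsto χ (𝓝[>] 0) (𝓝 0)) {η : ℝ} (hη : 0 < η) :
    ∃ M : ℕ, ∀ N ≥ M, ∀ f, TameDensity p Emax Smin L χ f → ∀ s > 0,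
      |√N * energyDev f * √(2 * Real.pi) * energyDensity N f s
        - Real.exp (-(s - N * energy f) ^ 2 / (2 * N * energyDev f ^ 2))| ≤ η := by
  obtain ⟨K, hK, hKf⟩ := exists_energyDev_sq_le (p := p) (Emax := Emax) (Smin := Smin) (L := L) hχ
  obtain ⟨m, hm, hmp⟩ := exists_dim_exponent_le hp
  -- Multiplying by `√N Σ` after inversion costs at most `√N √K`; hence the tolerance `η / √K`.
  obtain ⟨M, hM⟩ := exists_integral_norm_charSq_pow_sub_le (Emax := Emax) (L := L) hp hSmin hχ
    (η := η / √K) (by positivity)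
  have hfin : (1 + ENNReal.ofReal L ^ p) ≠ ∞ :=
    ENNReal.add_ne_top.2 ⟨by simp, ENNReal.rpow_ne_top_of_nonneg (by linarith) (by simp)⟩
  refine ⟨max M m, fun N hN f h s hs => ?_⟩
  have hNM : M ≤ N := (le_max_left _ _).trans hN
  have hNm : m ≤ N := (le_max_right _ _).trans hN
  have hN3 : 3 ≤ N := by omega
  have hN0 : (0 : ℝ) < N := by exact_mod_cast (by omega : 0 < N)
  have hlt := (eLpNorm_toReal_le h.measurable h.nonneg h.integrable h.integral_eq_one h.eLpNorm_le
    (hmp N hNm).1 (hmp N hNm).2).trans_lt hfin.lt_top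
  obtain ⟨hi, hle⟩ := hM N hNM f h
  set E := energy f with hE
  set S := energyDev f with hS
  have hS0 : 0 < S := hSmin.trans_le h.le_energyDev
  have hSK : S ≤ √K := Real.le_sqrt_of_sq_le (hKf f h)
  have hinv := fourier_inversion_exp
    (integrable_energyDensity hN3 h.measurable h.nonneg h.integrable h.integral_eq_one rfl hlt)
    (integral_exp_mul_energyDensity hN3 h.measurable h.nonneg rfl hlt) hi
    (continuousAt_energyDensity hN3 h.measurable rfl hlt hs)
  let A : ℝ → ℂ := fun t => (Complex.exp (-(Complex.I * (t * E))) * charSq f t) ^ N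
  let B : ℝ → ℂ := fun t => (Real.exp (-(N * (S ^ 2 * t ^ 2 / 2))) : ℝ)
  -- Centring each characteristic function by `E` changes the inversion phase from `-s` to `N E -
  -- s`.
  let e : ℝ → ℂ := fun t => Complex.exp (Complex.I * (N * E - s : ℝ) * t)
  have hAi : Integrable A := by
    refine hi.norm.mono' ?_ (.of_forall fun t => ?_)
    · have := continuous_charSq h.integrable
      exact (by fun_prop : Continuous A).aestronglyMeasurable
    · simp only [A]
      rw [norm_pow, norm_mul, norm_pow, show ‖Complex.exp (-(Complex.I * (t * E)))‖ = 1 by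
        simp [Complex.norm_exp], one_mul]
  have hBi : Integrable B := by
    have : Integrable fun t : ℝ => Real.exp (-(N * S ^ 2 / 2) * t ^ 2) :=
      integrable_exp_neg_mul_sq (by positivity)
    refine this.ofReal.congr (.of_forall fun t => ?_)
    simp only [B]
    congr 2
    ring
  have hen : ∀ t, ‖e t‖ = 1 := by
    intro t
    simp only [e]
    rw [Complex.norm_exp]
    simp
  have hec : Continuous e := by fun_prop
  have hAei : Integrable fun t => A t * e t :=
    hAi.norm.mono' (hAi.aestronglyMeasurable.mul hec.aestronglyMeasurable)
      (.of_forall fun t => by rw [norm_mul, hen, mul_one])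
  have hBei : Integrable fun t => B t * e t :=
    hBi.norm.mono' (hBi.aestronglyMeasurable.mul hec.aestronglyMeasurable)
      (.of_forall fun t => by rw [norm_mul, hen, mul_one])
  have hA : ∫ t : ℝ, charSq f t ^ N * Complex.exp (-(Complex.I * (t * s))) = ∫ t, A t * e t := by
    refine integral_congr_ae (.of_forall fun t => ?_)
    simp only [A, e]
    rw [mul_pow, ← Complex.exp_nat_mul, mul_comm (Complex.exp _), mul_assoc, ← Complex.exp_add]
    congr 2
    push_cast
    ring
  have hB : ∫ t, B t * e t = ((√(2 * Real.pi) / (√N * S) *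
      Real.exp (-(s - N * E) ^ 2 / (2 * N * S ^ 2)) : ℝ) : ℂ) := by
    have h1 : ∀ t, B t * e t = Complex.exp (Complex.I * (N * E - s : ℝ) * t)
        * Complex.exp (-((N * S ^ 2 / 2 : ℝ) : ℂ) * t ^ 2) := by
      intro t
      simp only [B, e]
      rw [mul_comm]
      congr 1
      push_cast
      congr 1
      ring
    simp_rw [h1]
    have hb : 0 < N * S ^ 2 / 2 := by positivity
    rw [fourierIntegral_gaussian (by rwa [Complex.ofReal_re])]
    have h2 : ((Real.pi : ℂ) / (N * S ^ 2 / 2 : ℝ)) ^ (1 / 2 : ℂ)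
        = (√(2 * Real.pi) / (√N * S) : ℝ) := by
      have h3 : √(2 * Real.pi) / (√N * S) = √(Real.pi / (N * S ^ 2 / 2)) := by
        rw [show √(N : ℝ) * S = √(N * S ^ 2) by rw [Real.sqrt_mul hN0.le, Real.sqrt_sq hS0.le],
          ← Real.sqrt_div (by positivity)]
        congr 1
        field_simp
      rw [h3, Real.sqrt_eq_rpow, Complex.ofReal_cpow (by positivity)]
      push_cast; rfl
    have h4 : Complex.exp (-((N * E - s : ℝ) : ℂ) ^ 2 / (4 * (N * S ^ 2 / 2 : ℝ)))
        = (Real.exp (-(s - N * E) ^ 2 / (2 * N * S ^ 2)) : ℝ) := by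
      push_cast
      congr 1
      ring
    rw [h2, h4]
    push_cast
    ring
  set c : ℝ := √N * S * √(2 * Real.pi) * (1 / (2 * Real.pi)) with hc
  have hsq2 : √(2 * Real.pi) * √(2 * Real.pi) = 2 * Real.pi := Real.mul_self_sqrt (by positivity)
  have hsN : 0 < √(N : ℝ) := Real.sqrt_pos.2 hN0
  have hkey : ((√N * S * √(2 * Real.pi) * energyDensity N f s
        - Real.exp (-(s - N * E) ^ 2 / (2 * N * S ^ 2)) : ℝ) : ℂ)
      = (c : ℂ) * ∫ t, (A t - B t) * e t := by
    simp_rw [sub_mul]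
    rw [integral_sub hAei hBei, hB, mul_sub, ← hA, Complex.ofReal_sub, Complex.ofReal_mul, hinv]
    congr 1
    · rw [hc]; push_cast; ring
    · rw [← Complex.ofReal_mul]
      congr 1
      rw [hc]
      have : √N * S * √(2 * Real.pi) * (1 / (2 * Real.pi)) * (√(2 * Real.pi) / (√N * S) *
          Real.exp (-(s - N * E) ^ 2 / (2 * N * S ^ 2)))
          = (√(2 * Real.pi) * √(2 * Real.pi)) / (2 * Real.pi) *
          Real.exp (-(s - N * E) ^ 2 / (2 * N * S ^ 2)) := by
        field_simp
      rw [this, hsq2, div_self (by positivity), one_mul]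
  have hc0 : 0 ≤ c := by positivity
  have hcle : c ≤ √N * √K := by
    have : √(2 * Real.pi) * (1 / (2 * Real.pi)) ≤ 1 := by
      rw [mul_one_div, div_le_one (by positivity), Real.sqrt_le_left (by positivity)]
      nlinarith [Real.pi_gt_three]
    calc c = √N * S * (√(2 * Real.pi) * (1 / (2 * Real.pi))) := by rw [hc]; ring
      _ ≤ √N * √K * 1 := by gcongr
      _ = _ := mul_one _
  rw [← Real.norm_eq_abs, ← Complex.norm_real, hkey, norm_mul, Complex.norm_real,
    Real.norm_of_nonneg hc0]
  have hI : ‖∫ t, (A t - B t) * e t‖ ≤ ∫ t, ‖A t - B t‖ := by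
    refine (norm_integral_le_integral_norm _).trans (le_of_eq ?_)
    refine integral_congr_ae (.of_forall fun t => ?_)
    simp only [norm_mul, hen, mul_one]
  have hI0 : 0 ≤ ∫ t, ‖A t - B t‖ := integral_nonneg fun t => norm_nonneg _
  calc c * ‖∫ t, (A t - B t) * e t‖ ≤ (√N * √K) * ∫ t, ‖A t - B t‖ := by gcongr
    _ = √K * (√N * ∫ t, ‖A t - B t‖) := by ring
    _ ≤ √K * (η / √K) := by gcongr
    _ = η := by field_simp

end CondTensor

end

/-! ### Gaussian reference density and conclusion -/

noncomputable section

namespace CondTensor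

open scoped ENNReal

/-- The standard Gaussian density on the line. -/
def stdGaussian (v : ℝ) : ℝ := (√(2 * Real.pi))⁻¹ * Real.exp (-(1 / 2) * v ^ 2)

theorem stdGaussian_pos (v : ℝ) : 0 < stdGaussian v := by unfold stdGaussian; positivity

theorem continuous_stdGaussian : Continuous stdGaussian := by unfold stdGaussian; fun_prop

theorem integrable_pow_mul_stdGaussian (n : ℕ) : Integrable fun v => v ^ n * stdGaussian v := by
  have h := (integrable_rpow_mul_exp_neg_mul_sq (b := 1 / 2) (by norm_num) (s := n)
    (by linarith [(Nat.cast_nonneg n : (0 : ℝ) ≤ n)])).const_mul (√(2 * Real.pi))⁻¹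
  refine h.congr (.of_forall fun v => ?_)
  simp only [Real.rpow_natCast, stdGaussian]
  ring

theorem integral_stdGaussian : ∫ v, stdGaussian v = 1 := by
  simp only [stdGaussian]
  rw [integral_const_mul, integral_gaussian, show Real.pi / (1 / 2) = 2 * Real.pi by ring]
  exact inv_mul_cancel₀ (by positivity)

theorem integral_pow_add_two_mul_stdGaussian (n : ℕ) :
    ∫ v, v ^ (n + 2) * stdGaussian v = (n + 1) * ∫ v, v ^ n * stdGaussian v := by
  have hu : ∀ v : ℝ, HasDerivAt (fun v : ℝ => v ^ (n + 1)) ((n + 1) * v ^ n) v := by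
    intro v
    simpa using hasDerivAt_pow (n + 1) v
  have hw : ∀ v : ℝ, HasDerivAt (fun v => -stdGaussian v) (v * stdGaussian v) v := by
    intro v
    have h1 : HasDerivAt (fun v : ℝ => -(1 / 2) * v ^ 2) (-v) v := by
      refine ((hasDerivAt_pow 2 v).const_mul (-(1 / 2))).congr_deriv ?_
      simp
    have h2 := ((h1.exp).const_mul (√(2 * Real.pi))⁻¹).neg
    refine h2.congr_deriv ?_
    simp only [stdGaussian]
    ring
  have h := integral_mul_deriv_eq_deriv_mul_of_integrable (u := fun v : ℝ => v ^ (n + 1))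
    (v := fun v => -stdGaussian v) (fun v _ => hu v) (fun v _ => hw v)
    ((integrable_pow_mul_stdGaussian (n + 2)).congr (.of_forall fun v => by
      simp only [Pi.mul_apply]; ring))
    (((integrable_pow_mul_stdGaussian n).const_mul (-(n + 1 : ℝ))).congr (.of_forall fun v => by
      simp only [Pi.mul_apply]; ring))
    ((integrable_pow_mul_stdGaussian (n + 1)).neg.congr (.of_forall fun v => by
      simp only [Pi.mul_apply, Pi.neg_apply]; ring))
  calc ∫ v, v ^ (n + 2) * stdGaussian v = ∫ v, v ^ (n + 1) * (v * stdGaussian v) := by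
        congr 1; ext v; ring
    _ = -∫ v, (n + 1) * v ^ n * -stdGaussian v := h
    _ = _ := by
        rw [← integral_neg, ← integral_const_mul]
        congr 1; ext v; ring

theorem energy_stdGaussian : energy stdGaussian = 1 := by
  have h := integral_pow_add_two_mul_stdGaussian 0
  simp only [zero_add, pow_zero, one_mul, integral_stdGaussian] at h
  rw [energy]
  simp_rw [mul_comm (stdGaussian _)]
  simpa using h

theorem energyDev_stdGaussian : energyDev stdGaussian = √2 := by
  have h0 := energy_stdGaussian
  have h2 : ∫ v, v ^ 2 * stdGaussian v = 1 := by
    rw [energy] at h0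
    simpa only [mul_comm] using h0
  have h4 := integral_pow_add_two_mul_stdGaussian 2
  rw [h2] at h4
  have hi : Integrable stdGaussian := by simpa using integrable_pow_mul_stdGaussian 0
  rw [energyDev, h0]
  congr 1
  have e : ∀ v : ℝ, (v ^ 2 - 1) ^ 2 * stdGaussian v
      = v ^ 4 * stdGaussian v - 2 * (v ^ 2 * stdGaussian v) + stdGaussian v := fun v => by ring
  simp_rw [e]
  have hi2 : Integrable fun v => v ^ 4 * stdGaussian v - 2 * (v ^ 2 * stdGaussian v) :=
    (integrable_pow_mul_stdGaussian 4).sub ((integrable_pow_mul_stdGaussian 2).const_mul 2)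
  rw [integral_add hi2 hi, integral_sub (integrable_pow_mul_stdGaussian 4)
    ((integrable_pow_mul_stdGaussian 2).const_mul 2), integral_const_mul, h2, h4,
    integral_stdGaussian]
  norm_num

theorem tendsto_tail_stdGaussian :
    Tendsto (fun r : ℝ => ∫ v in {v : ℝ | 1 / r ≤ |v|}, stdGaussian v * v ^ 4) (𝓝[>] 0) (𝓝 0) := by
  have hs : ∀ r : ℝ, MeasurableSet {v : ℝ | 1 / r ≤ |v|} := fun r =>
    measurableSet_le measurable_const (by fun_prop)
  have hi : Integrable fun v => stdGaussian v * v ^ 4 := by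
    simpa only [mul_comm] using integrable_pow_mul_stdGaussian 4
  simp_rw [← fun r => integral_indicator (f := fun v => stdGaussian v * v ^ 4) (μ := volume) (hs r)]
  have h := tendsto_integral_filter_of_dominated_convergence (μ := volume) (l := 𝓝[>] (0 : ℝ))
    (F := fun r v => {v : ℝ | 1 / r ≤ |v|}.indicator (fun v => stdGaussian v * v ^ 4) v)
    (f := fun _ => 0) (fun v => stdGaussian v * v ^ 4)
    (.of_forall fun r => (hi.indicator (hs r)).aestronglyMeasurable)
    (.of_forall fun r => .of_forall fun v => by
      refine (norm_indicator_le_norm_self _ _).trans (le_of_eq ?_)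
      have := stdGaussian_pos v
      exact Real.norm_of_nonneg (by positivity)) hi
    (.of_forall fun v => by
      refine tendsto_const_nhds.congr' ?_
      have h1 : ∀ᶠ r in 𝓝[>] (0 : ℝ), r < 1 / (|v| + 1) :=
        (tendsto_id.mono_left nhdsWithin_le_nhds).eventually_lt_const (by positivity)
      filter_upwards [h1, self_mem_nhdsWithin] with r hr hr0
      have hr0 : 0 < r := hr0
      rw [Set.indicator_of_notMem]
      simp only [Set.mem_ofPred_eq, not_le]
      rw [lt_div_iff₀ (by positivity)] at hr
      rw [lt_div_iff₀ hr0]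
      linarith)
  simpa using h

/-- Makes the local limit theorem available for the Gaussian itself, with its own fourth-moment tail
as tail function. -/
theorem exists_tameDensity_stdGaussian : ∃ L : ℝ, TameDensity 2 1 (√2) L
    (fun r : ℝ => ∫ v in {v : ℝ | 1 / r ≤ |v|}, stdGaussian v * v ^ 4) stdGaussian := by
  have hi : Integrable stdGaussian := by simpa using integrable_pow_mul_stdGaussian 0
  have hmem : MemLp stdGaussian (ENNReal.ofReal 2) volume := by
    rw [show ENNReal.ofReal 2 = 2 by norm_num,
      memLp_two_iff_integrable_sq continuous_stdGaussian.aestronglyMeasurable]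
    refine Integrable.mono' (hi.const_mul (√(2 * Real.pi))⁻¹)
      (continuous_stdGaussian.pow 2).aestronglyMeasurable (.of_forall fun v => ?_)
    rw [Real.norm_of_nonneg (sq_nonneg _), sq]
    have h1 : stdGaussian v ≤ (√(2 * Real.pi))⁻¹ := by
      unfold stdGaussian
      refine mul_le_of_le_one_right (by positivity) (Real.exp_le_one_iff.2 ?_)
      nlinarith [sq_nonneg v]
    exact mul_le_mul_of_nonneg_right h1 (stdGaussian_pos v).le
  refine ⟨(eLpNorm stdGaussian (ENNReal.ofReal 2) volume).toReal, ?_⟩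
  exact
    { measurable := continuous_stdGaussian.measurable
      nonneg := fun v => (stdGaussian_pos v).le
      integrable := hi
      integral_eq_one := integral_stdGaussian
      integrable_pow_four := by simpa only [mul_comm] using integrable_pow_mul_stdGaussian 4
      energy_le := energy_stdGaussian.le
      le_energyDev := energyDev_stdGaussian.ge
      eLpNorm_le := (ENNReal.ofReal_toReal hmem.eLpNorm_ne_top).ge
      tail_le := fun r _ => le_rfl }

theorem gaussRadial_eq (N : ℕ) (r : ℝ) :
    gaussRadial N r = Real.exp (-r ^ 2 / 2) / √(2 * Real.pi) ^ N := by
  rw [gaussRadial, Real.sqrt_eq_rpow, ← Real.rpow_natCast _ N, ← Real.rpow_mul (by positivity)]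
  congr 2
  ring

theorem alpha_sq {N : ℕ} (hN : 2 ≤ N) {r : ℝ} (hr : 0 < r) :
    alpha N (r ^ 2) = r ^ (N - 2) * Real.exp (-r ^ 2 / 2) := by
  rw [alpha]
  congr 1
  rw [← Real.rpow_natCast r 2, ← Real.rpow_mul hr.le, ← Real.rpow_natCast r (N - 2),
    Nat.cast_sub hN]
  congr 1
  push_cast
  ring

theorem sphereInt_stdGaussian (N : ℕ) (r : ℝ) :
    sphereInt N stdGaussian r = (surf N).real Set.univ * gaussRadial N r := by
  have h : ∀ y : Metric.sphere (0 : EuclideanSpace ℝ (Fin N)) 1,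
      ∏ j, stdGaussian ((r • (y : EuclideanSpace ℝ (Fin N))).ofLp j) = gaussRadial N r := by
    intro y
    simp only [stdGaussian]
    rw [Finset.prod_mul_distrib, ← Real.exp_sum, ← Finset.mul_sum, sum_sq_smul_sphere,
      Finset.prod_const, Finset.card_univ, Fintype.card_fin, gaussRadial_eq, div_eq_mul_inv, inv_pow,
      mul_comm]
    congr 2
    ring
  rw [sphereInt]
  simp_rw [h]
  rw [integral_const, smul_eq_mul]

/-- An exact identity. Both energy densities contain the area of the sphere, which cancels once
`sphereInt_stdGaussian` expresses it through the Gaussian density at `s = N`. What remains of the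
Gaussian factors is `γ^{(N)}(r) α_N(N) / α_N(r²)`. -/
theorem Z_eq_mul_div {N : ℕ} (hN : 2 ≤ N) {f : ℝ → ℝ} (hf : Measurable f) (hS : 0 < energyDev f)
    {r : ℝ} (hr : 0 < r) :
    Z N f r = √2 / energyDev f * gaussRadial N r * (alpha N N / alpha N (r ^ 2)) *
      ((√N * energyDev f * √(2 * Real.pi) * energyDensity N f (r ^ 2)) /
        (√N * √2 * √(2 * Real.pi) * energyDensity N stdGaussian N)) := by
  have hN0 : (0 : ℝ) < N := by exact_mod_cast (by omega : 0 < N)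
  have hsN : 0 < √(N : ℝ) := Real.sqrt_pos.2 hN0
  have hNsq : (N : ℝ) = √(N : ℝ) ^ 2 := (Real.sq_sqrt hN0.le).symm
  have hA : 0 < (surf N).real Set.univ :=
    ENNReal.toReal_pos (surf_univ_ne_zero (by omega)) (measure_ne_top _ _)
  have hD : energyDensity N stdGaussian N
      = 1 / 2 * √(N : ℝ) ^ (N - 2) * ((surf N).real Set.univ * gaussRadial N √N) := by
    conv_lhs => rw [hNsq]
    rw [energyDensity_sq hsN, sphereInt_stdGaussian]
  have hα : alpha N N = √(N : ℝ) ^ (N - 2) * Real.exp (-√(N : ℝ) ^ 2 / 2) := by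
    rw [← alpha_sq hN hsN, ← hNsq]
  rw [Z_eq_sphereInt hf, energyDensity_sq hr, hD, hα, alpha_sq hN hr, gaussRadial_eq, gaussRadial_eq]
  have : 0 < √(2 * Real.pi) := by positivity
  have : (0 : ℝ) < √2 := by positivity
  have := Real.exp_pos (-r ^ 2 / 2)
  have := Real.exp_pos (-√(N : ℝ) ^ 2 / 2)
  field_simp

theorem abs_div_sub_le {a b x η : ℝ} (hη : η ≤ 1 / 2) (hx0 : 0 ≤ x) (hx1 : x ≤ 1)
    (ha : |a - x| ≤ η) (hb : |b - 1| ≤ η) : |a / b - x| ≤ 4 * η := by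
  have hb' : 1 / 2 ≤ b := by linarith [(abs_le.1 hb).1]
  have hb0 : 0 < b := by linarith
  have h1 : a / b - x = ((a - x) - x * (b - 1)) / b := by field_simp; ring
  rw [h1, abs_div, abs_of_pos hb0, div_le_iff₀ hb0]
  calc |(a - x) - x * (b - 1)| ≤ |a - x| + |x * (b - 1)| := abs_sub _ _
    _ ≤ η + 1 * η := by
        rw [abs_mul, abs_of_nonneg hx0]
        gcongr
    _ ≤ 4 * η * b := by nlinarith [abs_nonneg (a - x)]

/-- The error in the asymptotics of `Z_N(f, r)`. -/
def relError (N : ℕ) (f : ℝ → ℝ) (r : ℝ) : ℝ :=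
  (√N * energyDev f * √(2 * Real.pi) * energyDensity N f (r ^ 2)) /
      (√N * √2 * √(2 * Real.pi) * energyDensity N stdGaussian N)
    - Real.exp (-(r ^ 2 - N * energy f) ^ 2 / (2 * N * energyDev f ^ 2))

variable {p Emax Smin L : ℝ} {χ : ℝ → ℝ}

/-- The local limit theorem is used twice: for `f` at `s = r²` in the numerator, and for the
Gaussian at its mean `s = N` in the denominator, where the limiting exponential equals `1`. -/
theorem exists_abs_relError_le (hp : 1 < p) (hSmin : 0 < Smin) (hχ : Tendsto χ (𝓝[>] 0) (𝓝 0))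
    {η : ℝ} (hη : 0 < η) :
    ∃ M : ℕ, ∀ N ≥ M, ∀ f, TameDensity p Emax Smin L χ f → ∀ r > 0, |relError N f r| ≤ η := by
  set η' := min (1 / 2) (η / 4) with hη'
  have hη'0 : 0 < η' := by positivity
  obtain ⟨Lg, hg⟩ := exists_tameDensity_stdGaussian
  obtain ⟨M₁, hM₁⟩ := exists_energyDensity_sub_gaussian_le (Emax := Emax) (L := L) hp hSmin hχ hη'0
  obtain ⟨M₂, hM₂⟩ := exists_energyDensity_sub_gaussian_le (Emax := 1) (L := Lg) one_lt_two
    (by positivity : 0 < √2) tendsto_tail_stdGaussian hη'0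
  refine ⟨max 1 (max M₁ M₂), fun N hN f h r hr => ?_⟩
  have hN1 : 1 ≤ N := (le_max_left _ _).trans hN
  have hN0 : (0 : ℝ) < N := by exact_mod_cast hN1
  have h1 := hM₁ N ((le_max_left _ _).trans ((le_max_right _ _).trans hN)) f h (r ^ 2)
    (by positivity)
  have h2 := hM₂ N ((le_max_right _ _).trans ((le_max_right _ _).trans hN)) stdGaussian hg N hN0
  rw [energy_stdGaussian, energyDev_stdGaussian] at h2
  have h3 : -((N : ℝ) - N * 1) ^ 2 / (2 * N * √2 ^ 2) = 0 := by simp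
  rw [h3, Real.exp_zero] at h2
  refine (abs_div_sub_le (min_le_left _ _) (Real.exp_pos _).le ?_ h1 h2).trans ?_
  · rw [Real.exp_le_one_iff]
    refine div_nonpos_of_nonpos_of_nonneg ?_ (by positivity)
    exact neg_nonpos.2 (sq_nonneg _)
  · linarith [min_le_right (1 / 2) (η / 4)]

/-- A uniform rate: the supremum of the errors tends to `0`. -/
theorem exists_uniform_rate (hp : 1 < p) (hSmin : 0 < Smin) (hχ : Tendsto χ (𝓝[>] 0) (𝓝 0)) :
    ∃ (ω : ℕ → ℝ) (M : ℕ), Tendsto ω atTop (𝓝 0) ∧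
      ∀ N ≥ M, ∀ f, TameDensity p Emax Smin L χ f → ∀ r > 0, |relError N f r| ≤ ω N := by
  let T : ℕ → Set ℝ := fun N =>
    {x | ∃ f, TameDensity p Emax Smin L χ f ∧ ∃ r > 0, x = |relError N f r|}
  have hT : ∀ η > 0, ∃ M : ℕ, ∀ N ≥ M, ∀ x ∈ T N, x ≤ η := by
    intro η hη
    obtain ⟨M, hM⟩ := exists_abs_relError_le (p := p) (Emax := Emax) (L := L) hp hSmin hχ hη
    refine ⟨M, fun N hN x hx => ?_⟩
    obtain ⟨f, hf, r, hr, rfl⟩ := hx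
    exact hM N hN f hf r hr
  obtain ⟨M, hM⟩ := hT 1 one_pos
  -- Beyond `M` the errors are bounded by `1`, so the supremum really bounds them.
  refine ⟨fun N => sSup (T N), M, ?_, fun N hN f hf r hr =>
    le_csSup ⟨1, hM N hN⟩ ⟨f, hf, r, hr, rfl⟩⟩
  rw [Metric.tendsto_atTop]
  intro η hη
  obtain ⟨K, hK⟩ := hT (η / 2) (half_pos hη)
  refine ⟨K, fun N hN => ?_⟩
  have h0 : 0 ≤ sSup (T N) := Real.sSup_nonneg fun x ⟨_, _, _, _, hx⟩ => hx ▸ abs_nonneg _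
  have h1 : sSup (T N) ≤ η / 2 := Real.sSup_le (hK N hN) (half_pos hη).le
  rw [Real.dist_eq, sub_zero, abs_of_nonneg h0]
  linarith

/-- Every admissible density has a tame representative. -/
theorem exists_tameDensity_ae_eq {f : ℝ → ℝ} (hf : IsProbDensity f)
    (hf4 : Integrable fun v => f v * v ^ 4) (hE : energy f ≤ Emax) (hS : Smin ≤ energyDev f)
    (hL : eLpNorm f (ENNReal.ofReal p) volume ≤ ENNReal.ofReal L)
    (htail : ∀ r > 0, (∫ v in {v : ℝ | 1 / r ≤ |v|}, f v * v ^ 4) ≤ χ r) :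
    ∃ g, g =ᵐ[volume] f ∧ energy g = energy f ∧ energyDev g = energyDev f ∧
      TameDensity p Emax Smin L χ g := by
  have hm := hf.integrable.aestronglyMeasurable
  -- A measurable representative, truncated at `0` so that nonnegativity holds everywhere.
  let g : ℝ → ℝ := fun v => max (hm.mk f v) 0
  have hgf : g =ᵐ[volume] f := by
    filter_upwards [hm.ae_eq_mk, hf.nonneg] with v hv hv0
    simp only [g]
    rw [← hv, max_eq_left hv0]
  have hEg : energy g = energy f := integral_congr_ae (hgf.mono fun v hv => by simp only [hv])
  have hSg : energyDev g = energyDev f := by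
    rw [energyDev, energyDev, hEg]
    congr 1
    exact integral_congr_ae (hgf.mono fun v hv => by simp only [hv])
  have h4 : (fun v => f v * v ^ 4) =ᵐ[volume] fun v => g v * v ^ 4 :=
    hgf.mono fun v hv => by simp only [hv]
  refine ⟨g, hgf, hEg, hSg, ?_⟩
  exact
    { measurable := hm.stronglyMeasurable_mk.measurable.max measurable_const
      nonneg := fun v => le_max_right _ _
      integrable := hf.integrable.congr hgf.symm
      integral_eq_one := (integral_congr_ae hgf).trans hf.integral_eq_one
      integrable_pow_four := hf4.congr h4
      energy_le := hEg.trans_le hE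
      le_energyDev := hS.trans_eq hSg.symm
      eLpNorm_le := (eLpNorm_congr_ae hgf).trans_le hL
      tail_le := fun r hr =>
        (integral_congr_ae (ae_restrict_of_ae h4)).symm.trans_le (htail r hr) }

end CondTensor

end

theorem mainTheorem6
    (p : ℝ) (hp : 1 < p) (Emin Emax Smin L : ℝ) (hEmin : 0 < Emin) (hSmin : 0 < Smin)
    (χ : ℝ → ℝ) (hχ_nonneg : ∀ r > 0, 0 ≤ χ r) (hχ_lim : Tendsto χ (𝓝[>] 0) (𝓝 0)) :
    ∃ (ω : ℕ → ℝ) (N₀ : ℕ), Tendsto ω atTop (𝓝 0) ∧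
      ∀ f : ℝ → ℝ, CondTensor.IsProbDensity f →
        Integrable (fun v => f v * v ^ 4) →
        MemLp f (ENNReal.ofReal p) →
        Emin ≤ CondTensor.energy f → CondTensor.energy f ≤ Emax →
        Smin ≤ CondTensor.energyDev f →
        eLpNorm f (ENNReal.ofReal p) volume ≤ ENNReal.ofReal L →
        (∀ r > 0, (∫ v in {v : ℝ | 1 / r ≤ |v|}, f v * v ^ 4) ≤ χ r) →
        ∀ N ≥ N₀,
          (∀ r > 0,
            -- the integral over the sphere is well defined for the class of `f`
            Integrable (CondTensor.tensorPow f N) (CondTensor.sphereUnif N r) ∧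
            (∀ g : ℝ → ℝ, g =ᵐ[volume] f → CondTensor.Z N g r = CondTensor.Z N f r) ∧
            ∃ ε : ℝ, |ε| ≤ ω N ∧
              CondTensor.Z N f r =
                Real.sqrt 2 / CondTensor.energyDev f * CondTensor.gaussRadial N r *
                  (CondTensor.alpha N N / CondTensor.alpha N (r ^ 2)) *
                  (Real.exp (-(r ^ 2 - N * CondTensor.energy f) ^ 2 /
                    (2 * N * CondTensor.energyDev f ^ 2)) + ε)) ∧
          ∃ ε : ℝ, |ε| ≤ ω N ∧
            CondTensor.Z N f (Real.sqrt N) =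
              Real.sqrt 2 / CondTensor.energyDev f * CondTensor.gaussRadial N (Real.sqrt N) *
                (Real.exp (-(N * (1 - CondTensor.energy f) ^ 2) /
                  (2 * CondTensor.energyDev f ^ 2)) + ε) := by
  obtain ⟨m, hm, hmp⟩ := CondTensor.exists_dim_exponent_le hp
  obtain ⟨ω, M, hω, hM⟩ := CondTensor.exists_uniform_rate (p := p) (Emax := Emax) (L := L) hp hSmin
    hχ_lim
  refine ⟨ω, max m M, hω, ?_⟩
  intro f hf hf4 _ _ hE hS hL htail N hN
  have hmN : m ≤ N := (le_max_left _ _).trans hN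
  have hMN : M ≤ N := (le_max_right _ _).trans hN
  have hN3 : 3 ≤ N := hm.trans hmN
  have hN0 : (0 : ℝ) < N := by exact_mod_cast (by omega : 0 < N)
  obtain ⟨g, hgf, hEg, hSg, hg⟩ := CondTensor.exists_tameDensity_ae_eq hf hf4 hE hS hL htail
  have hfin : (1 + ENNReal.ofReal L ^ p) ≠ ⊤ :=
    ENNReal.add_ne_top.2 ⟨by simp, ENNReal.rpow_ne_top_of_nonneg (by linarith) (by simp)⟩
  have hlt := (CondTensor.eLpNorm_toReal_le hg.measurable hg.nonneg hg.integrable hg.integral_eq_one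
    hg.eLpNorm_le (hmp N hmN).1 (hmp N hmN).2).trans_lt hfin.lt_top
  have hS0 : 0 < CondTensor.energyDev g := hSmin.trans_le hg.le_energyDev
  have hmain : ∀ r > 0, ∃ ε : ℝ, |ε| ≤ ω N ∧
      CondTensor.Z N f r =
        Real.sqrt 2 / CondTensor.energyDev f * CondTensor.gaussRadial N r *
          (CondTensor.alpha N N / CondTensor.alpha N (r ^ 2)) *
          (Real.exp (-(r ^ 2 - N * CondTensor.energy f) ^ 2 /
            (2 * N * CondTensor.energyDev f ^ 2)) + ε) := by
    intro r hr
    refine ⟨CondTensor.relError N g r, hM N hMN g hg r hr, ?_⟩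
    have hZ : CondTensor.Z N f r = CondTensor.Z N g r :=
      integral_congr_ae (CondTensor.tensorPow_ae_eq hN3 hgf.symm hr)
    rw [hZ, CondTensor.Z_eq_mul_div (by omega) hg.measurable hS0 hr, ← hEg, ← hSg,
      CondTensor.relError, add_sub_cancel]
  refine ⟨fun r hr => ⟨?_, ?_, hmain r hr⟩, ?_⟩
  · exact (CondTensor.integrable_tensorPow hN3 hg.measurable rfl hlt hr).congr
      (CondTensor.tensorPow_ae_eq hN3 hgf hr)
  · intro g' hg'
    exact integral_congr_ae (CondTensor.tensorPow_ae_eq hN3 hg' hr)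
  · obtain ⟨ε, hε, hZ⟩ := hmain √N (Real.sqrt_pos.2 hN0)
    refine ⟨ε, hε, ?_⟩
    have hα : CondTensor.alpha N N ≠ 0 := by
      rw [CondTensor.alpha]
      positivity
    -- At `r = √N` the two values of `α_N` coincide, and `(N - N E)² / (2 N Σ²)` simplifies to `N (1
    -- - E)² / (2 Σ²)`.
    rw [hZ, Real.sq_sqrt hN0.le, div_self hα, mul_one]
    congr 3
    have hS1 : CondTensor.energyDev f ≠ 0 := by rw [← hSg]; exact hS0.ne'
    field_simp
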